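/- Conventions. Let $n\ge 0$ and let $S_{n+1}$ act on $\{1,\dots,n+1\}$, with longest element $\omega_0$ and adjacent transpositions $s_1,\dots,s_n$; permutations are multiplied as functions. On $\mathbb Z[x_1,\dots,x_{n+1},y_1,\dots,y_{n+1}]$ put $$\delta_i(f)=\frac{f-s_if}{x_i-x_{i+1}},\qquad \pi_i(f)=\delta_i(f)+\delta_i(x_{i+1}f),$$ where $s_i$ interchanges $x_i$ and $x_{i+1}$ and fixes the other variables, and put $\pi_\sigma=\pi_{i_1}\cdots\pi_{i_\ell}$ for any reduced word $s_{i_1}\cdots s_{i_\ell}$ of $\sigma\in S_{n+1}$. The double Grothendieck polynomial of $\omega\in S_{n+1}$ is $$\mathfrak G_\omega(x,y)=\pi_{\omega^{-1}\omega_0}\Bigl(\prod_{i+j\le n+1}(x_i+y_j+x_iy_j)\Bigr),$$ where the product is over $i,j\ge 1$. Let $k,m\ge 0$ and $\omega\in S_{k+1}$. Let $\hat\omega\in S_{m+k+1}$ fix $1,\dots,m$ and act as $\omega$ on the last $k+1$ points. Write $\check x=(x_1,\dots,x_{m+1})$, $\hat x=(x_{m+2},\dots,x_{m+k+1})$, and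 likewise $\check y,\hat y$. The stable double Grothendieck polynomial of $\omega$ is $$\mathcal G_\omega(\check x,\check y)=\mathfrak G_{\hat\omega}(x,y)\big|_{\hat x=0=\hat y}.$$ Let $\bar s_i$ act on arrangements of $1,\dots,k+1$ by interchanging the values $i$ and $i+1$ if $i$ lies to the left of $i+1$, and by doing nothing otherwise. A Hecke word for $\omega$ is a word $i_1\cdots i_r$ in the letters $1,\dots,k$ such that $\bar s_{i_1}\cdots\bar s_{i_r}$, applied from right to left to $(1,2,\dots,k+1)$, gives the one-line notation of $\omega$. Let $\mathcal F^{\square}_\omega$ be the (finite) set of double Hecke factorizations of $\omega$ into $2m+2$ factors, that is, of all sequences $\mathfrak f=(f_{-(m+1)},\dots,f_{-1}\,|\,f_1,\dots,f_{m+1})$ of possibly empty words whose concatenation is a Hecke word for $\omega$, where $f_{-1},\dots,f_{-(m+1)}$ are strictly increasing and $f_1,\dots,f_{m+1}$ are strictly decreasing. Put $$(\check x,\check y)^{wt(\mathfrak f)}=\prod_{i=1}^{m+1}x_i^{|f_i|}\,y_i^{|f_{-i}|},$$ where $|f|$ is the length of $f$. Proposition. For all $k,m\ge 0$ and all $\omega\in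 S_{k+1}$, $$\mathcal G_\omega(\check x,\check y)=\sum_{\mathfrak f\in\mathcal F^{\square}_\omega}(\check x,\check y)^{wt(\mathfrak f)}.$$ -/

import Mathlib

open MvPolynomial Equiv

/-! ### Words in the adjacent transpositions

The letter `i : Fin n` stands for the transposition of the `i`-th and `(i+1)`-st points (counted
from `0`) of the `n + 1` permuted points. A permutation `ω` has one-line notation
`(ω 0, ω 1, …, ω n)`, and permutations are multiplied as functions. -/

/-- The adjacent transposition `s_i` in the symmetric group on `n + 1` points. -/
def adjTransp {n : ℕ} (i : Fin n) : Perm (Fin (n + 1)) := swap i.castSucc i.succ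

/-- The number of inversions of a permutation. -/
def inversionNumber {n : ℕ} (ω : Perm (Fin (n + 1))) : ℕ :=
  (Finset.univ.filter
    (fun p : Fin (n + 1) × Fin (n + 1) => p.1 < p.2 ∧ ω p.2 < ω p.1)).card

/-- `w = [i₁, …, i_ℓ]` is a reduced word for `ω`: `ω = s_{i₁} ⋯ s_{i_ℓ}`, where `ℓ` is the number
of inversions of `ω`. -/
def IsReducedWord {n : ℕ} (w : List (Fin n)) (ω : Perm (Fin (n + 1))) : Prop :=
  (w.map adjTransp).prod = ω ∧ w.length = inversionNumber ω

theorem adjTransp_lt {n : ℕ} (i : Fin n) (a b : Fin (n + 1)) (hab : a < b)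
    (hne : ¬ (a = i.castSucc ∧ b = i.succ)) : adjTransp i a < adjTransp i b := by
  unfold adjTransp
  rw [swap_apply_def, swap_apply_def]
  simp only [Fin.ext_iff, Fin.lt_def, Fin.val_castSucc, Fin.val_succ] at hab hne ⊢
  split_ifs <;> (try simp only [Fin.val_castSucc, Fin.val_succ]) <;> omega

theorem inversionNumber_descent {n : ℕ} (ω : Perm (Fin (n + 1))) (i : Fin n)
    (h : ω i.succ < ω i.castSucc) :
    inversionNumber ω = inversionNumber (ω * adjTransp i) + 1 := by
  classical
  have hs : ∀ a, adjTransp i (adjTransp i a) = a := fun a => by simp [adjTransp]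
  have hl : adjTransp i i.castSucc = i.succ := by simp [adjTransp]
  have hr : adjTransp i i.succ = i.castSucc := by simp [adjTransp]
  have hlt : i.castSucc < i.succ := Fin.castSucc_lt_succ
  unfold inversionNumber
  rw [← Finset.card_map (s := Finset.univ.filter (fun p : Fin (n + 1) × Fin (n + 1) =>
      p.1 < p.2 ∧ (ω * adjTransp i) p.2 < (ω * adjTransp i) p.1))
      (Equiv.prodCongr (adjTransp i) (adjTransp i)).toEmbedding,
    ← Finset.card_insert_of_notMem (a := (i.castSucc, i.succ))]
  · congr 1
    ext ⟨a, b⟩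
    simp only [Finset.mem_filter, Finset.mem_univ, true_and, Finset.mem_insert, Prod.mk.injEq,
      Finset.mem_map, Equiv.coe_toEmbedding, Prod.exists, Equiv.prodCongr_apply, Prod.map_apply]
    simp only [Perm.coe_mul, Function.comp_apply]
    constructor
    · rintro ⟨h1, h2⟩
      by_cases hab : a = i.castSucc ∧ b = i.succ
      · exact Or.inl hab
      · refine Or.inr ⟨adjTransp i a, adjTransp i b, ⟨adjTransp_lt i a b h1 hab, ?_⟩, hs a, hs b⟩
        rwa [hs, hs]
    · rintro (⟨rfl, rfl⟩ | ⟨c, d, ⟨h1, h2⟩, rfl, rfl⟩)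
      · exact ⟨hlt, h⟩
      · refine ⟨adjTransp_lt i c d h1 ?_, h2⟩
        rintro ⟨rfl, rfl⟩
        rw [hl, hr] at h2
        exact lt_asymm h h2
  · simp only [Finset.mem_map, Finset.mem_filter, Finset.mem_univ, true_and, Prod.exists,
      Equiv.coe_toEmbedding, Equiv.prodCongr_apply, Prod.map_apply, Prod.mk.injEq]
    rintro ⟨c, d, ⟨h1, -⟩, hc, hd⟩
    have hc' : c = i.succ := by rw [← hs c, hc, hl]
    have hd' : d = i.castSucc := by rw [← hs d, hd, hr]
    rw [hc', hd'] at h1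
    exact lt_asymm h1 hlt

/-- Every permutation has a reduced word. -/
theorem exists_isReducedWord {n : ℕ} (ω : Perm (Fin (n + 1))) :
    ∃ w : List (Fin n), IsReducedWord w ω := by
  induction hN : inversionNumber ω generalizing ω with
  | zero =>
    refine ⟨[], ?_, hN.symm⟩
    have hmono : StrictMono ω := by
      refine Fin.strictMono_iff_lt_succ.2 fun i => ?_
      by_contra hlt
      have hne : ω i.succ ≠ ω i.castSucc :=
        fun e => (Fin.castSucc_lt_succ (i := i)).ne' (ω.injective e)
      have := inversionNumber_descent ω i (lt_of_le_of_ne (not_lt.1 hlt) hne)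
      omega
    have : hmono.orderIsoOfSurjective ω ω.surjective = OrderIso.refl _ := Subsingleton.elim _ _
    ext a
    have ha := congrArg (fun e : Fin (n + 1) ≃o Fin (n + 1) => e a) this
    simp only [StrictMono.coe_orderIsoOfSurjective, OrderIso.refl_apply] at ha
    simp [ha]
  | succ N ih =>
    obtain ⟨i, hi⟩ : ∃ i : Fin n, ω i.succ < ω i.castSucc := by
      by_contra hno
      push Not at hno
      have hmono : Monotone ω := Fin.monotone_iff_le_succ.2 hno
      have : inversionNumber ω = 0 := by
        unfold inversionNumber
        rw [Finset.card_eq_zero, Finset.filter_eq_empty_iff]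
        rintro ⟨a, b⟩ - ⟨h1, h2⟩
        exact absurd (hmono h1.le) (not_le.2 h2)
      omega
    have hd := inversionNumber_descent ω i hi
    obtain ⟨w, hw1, hw2⟩ := ih (ω * adjTransp i) (by omega)
    refine ⟨w ++ [i], ?_, by rw [List.length_append, hw2, List.length_singleton, hd]⟩
    rw [List.map_append, List.prod_append, hw1]
    simp [mul_assoc, adjTransp]

/-- A reduced word for `ω`. -/
noncomputable def reducedWord {n : ℕ} (ω : Perm (Fin (n + 1))) : List (Fin n) :=
  (exists_isReducedWord ω).choose

/-! ### Divided differences and double Grothendieck polynomials -/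

theorem X_sub_X_dvd_sub_rename {σ : Type*} [DecidableEq σ] (a b : σ) (f : MvPolynomial σ ℤ) :
    (X a - X b) ∣ f - rename (swap a b) f := by
  induction f using MvPolynomial.induction_on with
  | C r => simp
  | add p q hp hq =>
    have := dvd_add hp hq
    rw [map_add]
    convert this using 1
    ring
  | mul_X p c hp =>
    have hc : (X a - X b : MvPolynomial σ ℤ) ∣ X c - X (swap a b c) := by
      rw [swap_apply_def]
      split_ifs with h1 h2
      · rw [h1]
      · rw [h2]
        exact ⟨-1, by ring⟩
      · simp
    rw [map_mul, rename_X]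
    have := dvd_add (hp.mul_right (X c : MvPolynomial σ ℤ))
      (hc.mul_left (rename (swap a b) p : MvPolynomial σ ℤ))
    convert this using 1
    ring

/-- The divided difference `(f - s f) / (z_a - z_b)`, where `s` interchanges the variables `z_a`
and `z_b`: the quotient of this division, which is exact. -/
noncomputable def dividedDifference {σ : Type*} [DecidableEq σ] (a b : σ)
    (f : MvPolynomial σ ℤ) : MvPolynomial σ ℤ :=
  (X_sub_X_dvd_sub_rename a b f).choose

/-- For `a ≠ b` the divided difference is characterized by its defining equation. -/
theorem dividedDifference_eq_iff {σ : Type*} [DecidableEq σ] {a b : σ} (hab : a ≠ b)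
    (f g : MvPolynomial σ ℤ) :
    dividedDifference a b f = g ↔ f - rename (swap a b) f = (X a - X b) * g := by
  have hspec : f - rename (swap a b) f = (X a - X b) * dividedDifference a b f :=
    (X_sub_X_dvd_sub_rename a b f).choose_spec
  constructor
  · rintro rfl
    exact hspec
  · intro h
    refine mul_left_cancel₀ ?_ (hspec.symm.trans h)
    exact sub_ne_zero.2 fun e => hab (X_injective e)

/-- The index type of the `N` variables `x` and the `N` variables `y`: `Sum.inl i` is the index of
`x_{i+1}` and `Sum.inr j` is the index of `y_{j+1}`. -/
abbrev XY (N : ℕ) : Type := Fin N ⊕ Fin N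

/-- The operator `π_i f = δ_i f + δ_i (x_{i+1} f)` on `ℤ[x, y]`, acting on the variables `x`
(and `ℤ[y]`-linearly), where `δ_i` is the divided difference in `x_i` and `x_{i+1}`. -/
noncomputable def isobaric {n : ℕ} (i : Fin n) (f : MvPolynomial (XY (n + 1)) ℤ) :
    MvPolynomial (XY (n + 1)) ℤ :=
  dividedDifference (Sum.inl i.castSucc) (Sum.inl i.succ) f +
    dividedDifference (Sum.inl i.castSucc) (Sum.inl i.succ) (X (Sum.inl i.succ) * f)

/-- The operator `π_{i₁} ⋯ π_{i_ℓ}` for a word `[i₁, …, i_ℓ]`. -/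
noncomputable def isobaricWord {n : ℕ} (w : List (Fin n)) (f : MvPolynomial (XY (n + 1)) ℤ) :
    MvPolynomial (XY (n + 1)) ℤ :=
  w.foldr isobaric f

/-- The operator `π_ω`; by the braid relations for the `π_i` it does not depend on the reduced
word of `ω`. -/
noncomputable def isobaricPerm {n : ℕ} (ω : Perm (Fin (n + 1)))
    (f : MvPolynomial (XY (n + 1)) ℤ) : MvPolynomial (XY (n + 1)) ℤ :=
  isobaricWord (reducedWord ω) f

/-- The double Grothendieck polynomial
`π_{ω⁻¹ ω₀} (∏_{i + j ≤ n + 1} (x_i + y_j + x_i y_j))` of a permutation `ω` of `n + 1` points,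
where `ω₀ = Fin.revPerm` is the longest permutation. The indices `i`, `j` of the formula run from
`1` to `n + 1`; those of the code start at `0`. -/
noncomputable def doubleGrothendieck {n : ℕ} (ω : Perm (Fin (n + 1))) :
    MvPolynomial (XY (n + 1)) ℤ :=
  isobaricPerm (ω⁻¹ * Fin.revPerm)
    (∏ p : Fin (n + 1) × Fin (n + 1) with (p.1.val + 1) + (p.2.val + 1) ≤ n + 1,
      (X (Sum.inl p.1) + X (Sum.inr p.2) + X (Sum.inl p.1) * X (Sum.inr p.2)))

/-! ### Stable double Grothendieck polynomials -/

/-- The permutation `ω̂` of `m + k + 1` points that fixes the first `m` points and acts as `ω` on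
the last `k + 1` points. -/
def shiftPerm (m : ℕ) {k : ℕ} (ω : Perm (Fin (k + 1))) : Perm (Fin (m + k + 1)) :=
  (finSumFinEquiv.permCongr (Equiv.Perm.sumCongr (1 : Perm (Fin m)) ω) :
    Perm (Fin (m + (k + 1))))

/-- The specialization `ℤ[x₁, …, x_N, y₁, …, y_N] → ℤ[x₁, …, x_M, y₁, …, y_M]` that puts
`x_i = 0 = y_i` for all `i > M`. -/
noncomputable def truncateXY (M N : ℕ) : MvPolynomial (XY N) ℤ →ₐ[ℤ] MvPolynomial (XY M) ℤ :=
  aeval (Sum.elim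
    (fun i => if h : i.val < M then X (Sum.inl ⟨i.val, h⟩) else 0)
    (fun j => if h : j.val < M then X (Sum.inr ⟨j.val, h⟩) else 0))

/-- The stable double Grothendieck polynomial of `ω` in the variables `x₁, …, x_{m+1}` and
`y₁, …, y_{m+1}`: the double Grothendieck polynomial of `ω̂` with all further variables set to
zero. -/
noncomputable def stableDoubleGrothendieck (m : ℕ) {k : ℕ} (ω : Perm (Fin (k + 1))) :
    MvPolynomial (XY (m + 1)) ℤ :=
  truncateXY (m + 1) (m + k + 1) (doubleGrothendieck (shiftPerm m ω))

/-! ### Hecke words and double Hecke factorizations -/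

/-- The operator `s̄_i` on arrangements (one-line notations) of `n + 1` values: it interchanges
the values `i` and `i + 1` if `i` lies to the left of `i + 1`, and does nothing otherwise. -/
def heckeAct {n : ℕ} (i : Fin n) (ω : Perm (Fin (n + 1))) : Perm (Fin (n + 1)) :=
  if ω.symm i.castSucc < ω.symm i.succ then adjTransp i * ω else ω

/-- `w` is a Hecke word for `ω`: applying its letters from right to left to the identity
arrangement gives `ω`. -/
def IsHeckeWord {n : ℕ} (w : List (Fin n)) (ω : Perm (Fin (n + 1))) : Prop :=
  w.foldr heckeAct 1 = ω

/-- The word obtained by reading `(left m) ⋯ (left 1) (left 0) | (right 0) (right 1) ⋯ (right m)`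
from left to right. -/
def readingWord {m k : ℕ} (left right : Fin (m + 1) → List (Fin k)) : List (Fin k) :=
  (List.ofFn left).reverse.flatten ++ (List.ofFn right).flatten

/-- An (unbounded) double Hecke factorization of `ω` into `2m + 2` factors. Here `left i` and
`right i` are the `(i+1)`-st factors to the left and to the right of the center. -/
@[ext]
structure DoubleHeckeFactorization (m : ℕ) {k : ℕ} (ω : Perm (Fin (k + 1))) where
  left : Fin (m + 1) → List (Fin k)
  right : Fin (m + 1) → List (Fin k)
  left_increasing : ∀ i, (left i).Pairwise (· < ·)
  right_decreasing : ∀ i, (right i).Pairwise (· > ·)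
  isHeckeWord : IsHeckeWord (readingWord left right) ω

/-- There are only finitely many double Hecke factorizations of `ω` into `2m + 2` factors. -/
instance DoubleHeckeFactorization.instFinite (m : ℕ) {k : ℕ} (ω : Perm (Fin (k + 1))) :
    Finite (DoubleHeckeFactorization m ω) := by
  let φ : DoubleHeckeFactorization m ω →
      (Fin (m + 1) → Finset (Fin k)) × (Fin (m + 1) → Finset (Fin k)) :=
    fun f => (fun i => (f.left i).toFinset, fun i => (f.right i).toFinset)
  refine Finite.of_injective φ fun f g h => ?_
  simp only [φ, Prod.mk.injEq, funext_iff, Finset.ext_iff, List.mem_toFinset] at h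
  refine DoubleHeckeFactorization.ext (funext fun i => ?_) (funext fun i => ?_)
  · exact List.Perm.eq_of_pairwise (fun a b _ _ h1 h2 => (lt_asymm h1 h2).elim)
      (f.left_increasing i) (g.left_increasing i)
      ((List.perm_ext_iff_of_nodup ((f.left_increasing i).imp ne_of_lt)
        ((g.left_increasing i).imp ne_of_lt)).2 (h.1 i))
  · exact List.Perm.eq_of_pairwise (fun a b _ _ h1 h2 => (lt_asymm h1 h2).elim)
      (f.right_decreasing i) (g.right_decreasing i)
      ((List.perm_ext_iff_of_nodup ((f.right_decreasing i).imp ne_of_gt)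
        ((g.right_decreasing i).imp ne_of_gt)).2 (h.2 i))

noncomputable instance DoubleHeckeFactorization.instFintype (m : ℕ) {k : ℕ}
    (ω : Perm (Fin (k + 1))) : Fintype (DoubleHeckeFactorization m ω) :=
  Fintype.ofFinite _

/-- The monomial `x^{x-weight} y^{y-weight}` of a factorization: the exponents of `x_i` and `y_i`
are the lengths of the `i`-th factors to the right and to the left of the center. -/
noncomputable def DoubleHeckeFactorization.weightMonomial {m k : ℕ} {ω : Perm (Fin (k + 1))}
    (f : DoubleHeckeFactorization m ω) : MvPolynomial (XY (m + 1)) ℤ :=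
  (∏ i, X (Sum.inl i) ^ (f.right i).length) * ∏ i, X (Sum.inr i) ^ (f.left i).length

/-!
# Stable double Grothendieck polynomials and double Hecke factorizations

The proof goes through the generating function of Fomin and Kirillov. Let `u_i` be the generators
of the 0-Hecke algebra, normalized by `u_i ^ 2 = u_i`, acting on the free module with basis the
permutations by `u_i e_ω = e_{s̄_i ω}`, and put `h_i(t) = 1 + t u_i`. Write `x ⊕ y = x + y + x y`.
With `A_i(t) = ⋯ h_{i+1}(t) h_i(t)` and `B_i(t) = h_i(t) h_{i+1}(t) ⋯`, the coefficient of `e_ω` in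
`⋯ B_1(y_1) B_0(y_0) A_0(x_0) A_1(x_1) ⋯ e_1` is the double Grothendieck polynomial of `ω`
(`doubleGrothendieck_eq_grothendieckVector`). This holds because these coefficients satisfy the
defining recursion.

* The coefficient of the longest permutation: by the Yang–Baxter equation the product equals
  a product of the factors `h_{i+j}(x_i ⊕ y_j)` along a staircase-shaped reduced word of the
  longest permutation (`IsHeckeFamily.ascStaircase_mul_descStaircase`), and only the full word
  contributes (`heckeFactorProd_apply_of_reduced`).
* The step with `π_i`: since `A_i(x)` and `A_i(y)` commute, the product times `h_i(x_{i+1})` is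
  symmetric in `x_i` and `x_{i+1}` (`IsHeckeFamily.descStaircase_mul_heckeFactor`). Right
  multiplication by `u_i` is the right 0-Hecke action, which commutes with the left one, so
  comparing coefficients at `ω` and `ω s_i` gives `π_i G_ω = G_{ω s_i}` at each descent `i` of `ω`
  (`isobaric_grothendieckVector`). Following a reduced word this way needs no braid relations for
  the operators `π_i`.

For the permutation `ω̂` the letters below `m` cannot contribute, because `ω̂` has no left descent
there. So after the truncation all the factors `A_i` and `B_j` with `i, j ≤ m` run over the same `k`
letters (`stableDoubleGrothendieck_eq`). Expanding each `A_i` as a sum over strictly decreasing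
words and each `B_j` as a sum over strictly increasing words gives the sum over the double Hecke
factorizations.
-/

/-! ### Products of Hecke factors in an algebra with 0-Hecke generators -/

/-- The relations of the 0-Hecke algebra, in the normalization `u_i ^ 2 = u_i`. -/
structure IsHeckeFamily {A : Type*} [Ring A] (u : ℕ → A) : Prop where
  idem : ∀ i, u i * u i = u i
  comm : ∀ i j, i + 2 ≤ j → Commute (u i) (u j)
  braid : ∀ i, u i * u (i + 1) * u i = u (i + 1) * u i * u (i + 1)

section HeckeFamily

variable {R A : Type*} [CommRing R] [Ring A] [Algebra R A]

/-- The Hecke factor `h_i(t) = 1 + t u_i`. -/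
def heckeFactor (u : ℕ → A) (i : ℕ) (t : R) : A := 1 + t • u i

/-- The descending product `h_{a+l-1}(t) ⋯ h_{a+1}(t) h_a(t)`. -/
def descProd (u : ℕ → A) : ℕ → ℕ → R → A
  | _, 0, _ => 1
  | a, l + 1, t => descProd u (a + 1) l t * heckeFactor u a t

/-- The ascending product `h_a(t) h_{a+1}(t) ⋯ h_{a+l-1}(t)`. -/
def ascProd (u : ℕ → A) : ℕ → ℕ → R → A
  | _, 0, _ => 1
  | a, l + 1, t => heckeFactor u a t * ascProd u (a + 1) l t

/-- The product of the `descProd u (a + i) (l - i) (x i)` for `i = 0, …, l - 1`, in this order. -/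
def descStaircase (u : ℕ → A) : ℕ → ℕ → (ℕ → R) → A
  | _, 0, _ => 1
  | a, l + 1, x => descProd u a (l + 1) (x 0) * descStaircase u (a + 1) l (fun i => x (i + 1))

/-- The product of the `ascProd u (a + j) (l - j) (y j)` for `j = l - 1, …, 0`, in this order. -/
def ascStaircase (u : ℕ → A) : ℕ → ℕ → (ℕ → R) → A
  | _, 0, _ => 1
  | a, l + 1, y => ascStaircase u (a + 1) l (fun j => y (j + 1)) * ascProd u a (l + 1) (y 0)

/-- The letters and parameters of `∏_{i < l} h_{a+i}(x_i ⊕ s)`, where `x ⊕ s = x + s + x s`. -/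
def diagonalList : ℕ → ℕ → (ℕ → R) → R → List (ℕ × R)
  | _, 0, _, _ => []
  | a, l + 1, x, s =>
    (a, x 0 + s + x 0 * s) :: diagonalList (a + 1) l (fun i => x (i + 1)) s

/-- The letters and parameters of the product of all `h_{a+i+j}(x_i ⊕ y_j)` with `i + j < l`,
ordered by decreasing `j` and then by increasing `i`. -/
def triangleList : ℕ → ℕ → (ℕ → R) → (ℕ → R) → List (ℕ × R)
  | _, 0, _, _ => []
  | a, l + 1, x, y =>
    triangleList (a + 1) l x (fun j => y (j + 1)) ++ diagonalList a (l + 1) x (y 0)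

/-- The product of the Hecke factors with the given letters and parameters. -/
def heckeFactorProd (u : ℕ → A) (w : List (ℕ × R)) : A :=
  (w.map fun p => heckeFactor u p.1 p.2).prod

variable {u : ℕ → A}

theorem heckeFactor_zero (u : ℕ → A) (i : ℕ) : heckeFactor u i (0 : R) = 1 := by
  simp [heckeFactor]

theorem descProd_zero (u : ℕ → A) (a l : ℕ) : descProd u a l (0 : R) = 1 := by
  induction l generalizing a with
  | zero => rfl
  | succ l ih => rw [descProd, ih, heckeFactor_zero, one_mul]

theorem ascProd_zero (u : ℕ → A) (a l : ℕ) : ascProd u a l (0 : R) = 1 := by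
  induction l generalizing a with
  | zero => rfl
  | succ l ih => rw [ascProd, ih, heckeFactor_zero, one_mul]

theorem descStaircase_zero (u : ℕ → A) (a l : ℕ) :
    descStaircase u a l (fun _ => (0 : R)) = 1 := by
  induction l generalizing a with
  | zero => rfl
  | succ l ih => rw [descStaircase, ih, descProd_zero, one_mul]

theorem ascStaircase_zero (u : ℕ → A) (a l : ℕ) :
    ascStaircase u a l (fun _ => (0 : R)) = 1 := by
  induction l generalizing a with
  | zero => rfl
  | succ l ih => rw [ascStaircase, ih, ascProd_zero, one_mul]

namespace IsHeckeFamily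

theorem commute_heckeFactor (hu : IsHeckeFamily u) {i j : ℕ} (hij : i + 2 ≤ j) (s t : R) :
    Commute (heckeFactor u i s) (heckeFactor u j t) :=
  (Commute.one_left _).add_left
    (((Commute.one_right _).add_right ((hu.comm i j hij).smul_right t)).smul_left s)

theorem commute_descProd (hu : IsHeckeFamily u) {i a : ℕ} (l : ℕ) (hia : i + 2 ≤ a) (s t : R) :
    Commute (heckeFactor u i s) (descProd u a l t) := by
  induction l generalizing a with
  | zero => exact Commute.one_right _
  | succ l ih => exact (ih (by omega)).mul_right (hu.commute_heckeFactor hia s t)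

theorem commute_ascProd (hu : IsHeckeFamily u) {i a : ℕ} (l : ℕ) (hia : i + 2 ≤ a) (s t : R) :
    Commute (heckeFactor u i s) (ascProd u a l t) := by
  induction l generalizing a with
  | zero => exact Commute.one_right _
  | succ l ih => exact (hu.commute_heckeFactor hia s t).mul_right (ih (by omega))

theorem commute_descStaircase (hu : IsHeckeFamily u) {i a : ℕ} (l : ℕ) (hia : i + 2 ≤ a) (s : R)
    (x : ℕ → R) : Commute (heckeFactor u i s) (descStaircase u a l x) := by
  induction l generalizing a x with
  | zero => exact Commute.one_right _
  | succ l ih => exact (hu.commute_descProd _ hia s _).mul_right (ih (by omega) _)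

theorem heckeFactor_mul_self (hu : IsHeckeFamily u) (i : ℕ) (s t : R) :
    heckeFactor u i s * heckeFactor u i t = heckeFactor u i (t + s + t * s) := by
  simp only [heckeFactor, mul_add, add_mul, one_mul, mul_one, smul_mul_assoc, mul_smul_comm,
    hu.idem]
  module

/-- The Yang–Baxter equation for the Hecke factors. -/
theorem yangBaxter (hu : IsHeckeFamily u) (i : ℕ) (s t : R) :
    heckeFactor u i s * heckeFactor u (i + 1) (t + s + t * s) * heckeFactor u i t =
      heckeFactor u (i + 1) t * heckeFactor u i (t + s + t * s) * heckeFactor u (i + 1) s := by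
  have h1 := hu.idem i
  have h2 := hu.idem (i + 1)
  have h3 := hu.braid i
  simp only [heckeFactor, mul_add, add_mul, one_mul, mul_one, smul_mul_assoc, mul_smul_comm,
    h1, h2, h3]
  module

/-- A consequence of the Yang–Baxter equation: the form with `h_{i+1}(y ⊖ x)` on the left-hand side,
cleared of the denominator `1 + x`. -/
theorem yangBaxter_cleared (hu : IsHeckeFamily u) (i : ℕ) (x y : R) :
    heckeFactor u (i + 1) y * ((1 + x) • 1 - x • u (i + 1)) *
        (heckeFactor u i y * heckeFactor u (i + 1) x * heckeFactor u i x) =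
      (1 + x) • (heckeFactor u i x * heckeFactor u (i + 1) y * heckeFactor u i y) := by
  have h1 := hu.idem i
  have h2 := hu.idem (i + 1)
  have h3 := hu.braid i
  simp only [heckeFactor, mul_add, add_mul, mul_sub, sub_mul, one_mul, mul_one, smul_mul_assoc,
    mul_smul_comm, smul_add, smul_sub, ← mul_assoc, h1, h2, h3]
  module

/-- Descending products over the same letters commute. The Yang–Baxter equation is used with the
parameter `y ⊖ x = (y - x) / (1 + x)`, hence the regularity of `1 + x`. -/
theorem descProd_mul_comm (hu : IsHeckeFamily u) {x : R} (hx : IsSMulRegular A (1 + x)) (y : R)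
    (a l : ℕ) :
    descProd u a l x * descProd u a l y = descProd u a l y * descProd u a l x := by
  induction l generalizing a with
  | zero => rfl
  | succ l ih =>
    cases l with
    | zero =>
      simp only [descProd, one_mul, hu.heckeFactor_mul_self]
      congr 1
      ring
    | succ l =>
      -- Both sides are `Q(s, t)` times a product of three factors, where `Q(s, t)` is the product
      -- of the parts over the letters above `a` and, for `t`, above `a + 1`.
      have key : ∀ s t : R, descProd u a (l + 2) s * descProd u a (l + 2) t =
          descProd u (a + 1) (l + 1) s * descProd u (a + 2) l t *
            (heckeFactor u a s * heckeFactor u (a + 1) t * heckeFactor u a t) := fun s t => by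
        have hc := (hu.commute_descProd l (le_refl (a + 2)) s t).eq
        simp only [descProd, mul_assoc] at hc ⊢
        rw [← mul_assoc (heckeFactor u a s), hc, mul_assoc]
      have hs : descProd u (a + 1) (l + 1) x * descProd u (a + 2) l y * heckeFactor u (a + 1) y =
          descProd u (a + 1) (l + 1) y * descProd u (a + 2) l x * heckeFactor u (a + 1) x := by
        have := ih (a + 1)
        simpa only [descProd, mul_assoc] using this
      -- The inverse of `h_{a+1}(x)` is `h_{a+1}(⊖x)`, here multiplied by `1 + x`.
      have hinv : heckeFactor u (a + 1) x * ((1 + x) • 1 - x • u (a + 1)) =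
          (1 + x) • (1 : A) := by
        simp only [heckeFactor, add_mul, mul_sub, one_mul, mul_one, smul_mul_assoc,
          mul_smul_comm, hu.idem]
        module
      apply hx
      change (1 + x) • _ = (1 + x) • _
      rw [key, key, ← mul_smul_comm, ← hu.yangBaxter_cleared]
      set c : A := (1 + x) • 1 - x • u (a + 1)
      set Z := heckeFactor u a y * heckeFactor u (a + 1) x * heckeFactor u a x
      calc _ = descProd u (a + 1) (l + 1) x * descProd u (a + 2) l y *
            heckeFactor u (a + 1) y * c * Z := by simp only [mul_assoc]
        _ = descProd u (a + 1) (l + 1) y * descProd u (a + 2) l x *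
            (heckeFactor u (a + 1) x * c) * Z := by rw [hs]; simp only [mul_assoc]
        _ = _ := by rw [hinv, mul_smul_comm, mul_one, smul_mul_assoc]

/-- The staircase times `h_{a+j}(x_{j+1})` is symmetric in `x_j` and `x_{j+1}`, because this extra
factor completes two consecutive descending products to products over the same letters. -/
theorem descStaircase_mul_heckeFactor (hu : IsHeckeFamily u) (l j : ℕ) (hj : j < l) (a : ℕ)
    (x : ℕ → R) (hx : IsSMulRegular A (1 + x j)) :
    descStaircase u a l x * heckeFactor u (a + j) (x (j + 1)) =
      descStaircase u a l (fun i => x (swap j (j + 1) i)) * heckeFactor u (a + j) (x j) := by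
  induction j generalizing a l x with
  | zero =>
    obtain ⟨l, rfl⟩ : ∃ l', l = l' + 1 := ⟨l - 1, by omega⟩
    have hs : ∀ i, swap 0 1 (i + 2) = i + 2 := fun i =>
      swap_apply_of_ne_of_ne (by omega) (by omega)
    cases l with
    | zero =>
      simp only [descStaircase, descProd, one_mul, mul_one, zero_add, add_zero, swap_apply_left,
        hu.heckeFactor_mul_self]
      congr 1
      ring
    | succ l =>
      have key : ∀ z : ℕ → R, descStaircase u a (l + 2) z * heckeFactor u a (z 1) =
          descProd u a (l + 2) (z 0) * descProd u a (l + 2) (z 1) *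
            descStaircase u (a + 2) l (fun i => z (i + 2)) := fun z => by
        have hc := (hu.commute_descStaircase l (le_refl (a + 2)) (z 1) (fun i => z (i + 2))).eq
        change descProd u a (l + 2) (z 0) * (descProd u (a + 1) (l + 1) (z 1) *
            descStaircase u (a + 2) l (fun i => z (i + 2))) * heckeFactor u a (z 1) =
          descProd u a (l + 2) (z 0) * (descProd u (a + 1) (l + 1) (z 1) * heckeFactor u a (z 1)) *
            descStaircase u (a + 2) l (fun i => z (i + 2))
        simp only [mul_assoc, hc]
      have h1 := key x
      have h2 := key (fun i => x (swap 0 1 i))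
      simp only [swap_apply_left, swap_apply_right, hs] at h2
      simp only [add_zero, zero_add]
      rw [h1, h2, hu.descProd_mul_comm hx]
  | succ j ih =>
    obtain ⟨l, rfl⟩ : ∃ l', l = l' + 1 := ⟨l - 1, by omega⟩
    have h := ih l (by omega) (a + 1) (fun i => x (i + 1)) hx
    have hs : ∀ i, swap (j + 1) (j + 1 + 1) (i + 1) = swap j (j + 1) i + 1 := fun i => by
      simp only [swap_apply_def, Nat.add_right_cancel_iff]
      split_ifs <;> rfl
    have h0 : swap (j + 1) (j + 1 + 1) 0 = 0 := swap_apply_of_ne_of_ne (by omega) (by omega)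
    simp only [descStaircase, hs, h0, mul_assoc]
    rw [show a + (j + 1) = a + 1 + j by omega, h]

/-- The basic step of the Cauchy identity: `B_a(y) A_a(x) = A_{a+1}(x) h_a(x ⊕ y) B_{a+1}(y)`, where
`A` and `B` are the descending and the ascending products. -/
theorem ascProd_mul_descProd (hu : IsHeckeFamily u) (a l : ℕ) (x y : R) :
    ascProd u a (l + 1) y * descProd u a (l + 1) x =
      descProd u (a + 1) l x * heckeFactor u a (x + y + x * y) * ascProd u (a + 1) l y := by
  induction l generalizing a with
  | zero => simp only [ascProd, descProd, one_mul, mul_one, hu.heckeFactor_mul_self]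
  | succ l ih =>
    have h1 := (hu.commute_descProd l (le_refl (a + 2)) y x).eq
    have h2 := (hu.commute_ascProd l (le_refl (a + 2)) x y).eq
    have h3 := hu.yangBaxter a y x
    calc ascProd u a (l + 2) y * descProd u a (l + 2) x
        = heckeFactor u a y * (ascProd u (a + 1) (l + 1) y * descProd u (a + 1) (l + 1) x) *
            heckeFactor u a x := by simp only [ascProd, descProd, mul_assoc]
      _ = (heckeFactor u a y * descProd u (a + 2) l x) *
            heckeFactor u (a + 1) (x + y + x * y) *
            (ascProd u (a + 2) l y * heckeFactor u a x) := by rw [ih]; simp only [mul_assoc]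
      _ = descProd u (a + 2) l x * (heckeFactor u a y *
            heckeFactor u (a + 1) (x + y + x * y) * heckeFactor u a x) *
            ascProd u (a + 2) l y := by rw [h1, ← h2]; simp only [mul_assoc]
      _ = _ := by rw [h3]; simp only [ascProd, descProd, mul_assoc]

/-- An ascending product passes through a descending staircase, shortening it and leaving behind one
diagonal of the triangle of Hecke factors. -/
theorem ascProd_mul_descStaircase (hu : IsHeckeFamily u) (a l : ℕ) (x : ℕ → R) (y : R) :
    ascProd u a (l + 1) y * descStaircase u a (l + 1) x =
      descStaircase u (a + 1) l x * heckeFactorProd u (diagonalList a (l + 1) x y) := by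
  induction l generalizing a x with
  | zero =>
    simp only [descStaircase, mul_one, hu.ascProd_mul_descProd]
    simp [heckeFactorProd, diagonalList, descProd, ascProd]
  | succ l ih =>
    have hc := (hu.commute_descStaircase l (le_refl (a + 2)) (x 0 + y + x 0 * y)
      (fun i => x (i + 1))).eq
    rw [descStaircase, ← mul_assoc, hu.ascProd_mul_descProd, mul_assoc, ih, mul_assoc,
      ← mul_assoc (heckeFactor u a _), hc, descStaircase]
    change _ = _ * heckeFactorProd u
      ((a, x 0 + y + x 0 * y) :: diagonalList (a + 1) (l + 1) (fun i => x (i + 1)) y)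
    simp only [heckeFactorProd, List.map_cons, List.prod_cons, mul_assoc]

/-- The Cauchy identity: the product of the two staircases is a product of one Hecke factor for
each cell of the triangle. -/
theorem ascStaircase_mul_descStaircase (hu : IsHeckeFamily u) (a l : ℕ) (x y : ℕ → R) :
    ascStaircase u a l y * descStaircase u a l x = heckeFactorProd u (triangleList a l x y) := by
  induction l generalizing a y with
  | zero => simp [ascStaircase, descStaircase, triangleList, heckeFactorProd]
  | succ l ih =>
    rw [ascStaircase, mul_assoc, hu.ascProd_mul_descStaircase, ← mul_assoc, ih, triangleList]
    simp only [heckeFactorProd, List.map_append, List.prod_append]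

end IsHeckeFamily

end HeckeFamily

/-! ### The left and right 0-Hecke actions on permutations -/

theorem adjTransp_adjTransp {n : ℕ} (i : Fin n) (a : Fin (n + 1)) :
    adjTransp i (adjTransp i a) = a := by simp [adjTransp]

theorem adjTransp_mul_self {n : ℕ} (i : Fin n) : adjTransp i * adjTransp i = 1 := by
  simp [adjTransp]

theorem adjTransp_inv {n : ℕ} (i : Fin n) : (adjTransp i)⁻¹ = adjTransp i := by
  simp [adjTransp]

theorem adjTransp_castSucc {n : ℕ} (i : Fin n) : adjTransp i i.castSucc = i.succ := by
  simp [adjTransp]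

theorem adjTransp_succ {n : ℕ} (i : Fin n) : adjTransp i i.succ = i.castSucc := by
  simp [adjTransp]

/-- The left action sorts the positions of the values `i` and `i + 1` into decreasing order. -/
theorem heckeAct_symm_apply {n : ℕ} (i : Fin n) (ω : Perm (Fin (n + 1))) (p : Fin (n + 1)) :
    (heckeAct i ω).symm p =
      if p = i.castSucc then max (ω.symm i.castSucc) (ω.symm i.succ)
      else if p = i.succ then min (ω.symm i.castSucc) (ω.symm i.succ)
      else ω.symm p := by
  have hs : ∀ q, (adjTransp i * ω).symm q = ω.symm (adjTransp i q) := fun q => by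
    rw [← Perm.inv_def, mul_inv_rev, adjTransp_inv]
    rfl
  have hne : i.succ ≠ i.castSucc := Fin.castSucc_lt_succ.ne'
  unfold heckeAct
  split_ifs with h h1 h2 h1 h2
  · rw [hs, h1, adjTransp_castSucc, max_eq_right h.le]
  · rw [hs, h2, adjTransp_succ, min_eq_left h.le]
  · rw [hs, adjTransp, swap_apply_of_ne_of_ne h1 h2]
  · rw [h1, max_eq_left (not_lt.1 h)]
  · rw [h2, min_eq_right (not_lt.1 h)]
  · rfl

theorem heckeAct_heckeAct {n : ℕ} (i : Fin n) (ω : Perm (Fin (n + 1))) :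
    heckeAct i (heckeAct i ω) = heckeAct i ω := by
  have hne : i.succ ≠ i.castSucc := Fin.castSucc_lt_succ.ne'
  apply Equiv.symm_bijective.injective
  ext1 p
  simp only [heckeAct_symm_apply, hne, if_true, if_false]
  split_ifs <;> simp

theorem heckeAct_comm {n : ℕ} {i j : Fin n} (hij : i.val + 2 ≤ j.val) (ω : Perm (Fin (n + 1))) :
    heckeAct i (heckeAct j ω) = heckeAct j (heckeAct i ω) := by
  have h1 : i.castSucc ≠ j.castSucc := by simp [Fin.ext_iff]; omega
  have h2 : i.castSucc ≠ j.succ := by simp [Fin.ext_iff]; omega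
  have h3 : i.succ ≠ j.castSucc := by simp [Fin.ext_iff]; omega
  have h4 : i.succ ≠ j.succ := by simp [Fin.ext_iff]; omega
  apply Equiv.symm_bijective.injective
  ext1 p
  simp only [heckeAct_symm_apply, h1, h2, h3, h4, h1.symm, h2.symm, h3.symm, h4.symm, if_false]
  split_ifs <;> simp_all

theorem heckeAct_braid {n : ℕ} {i j : Fin n} (hij : j.val = i.val + 1) (ω : Perm (Fin (n + 1))) :
    heckeAct i (heckeAct j (heckeAct i ω)) = heckeAct j (heckeAct i (heckeAct j ω)) := by
  have h0 : j.castSucc = i.succ := by simp [Fin.ext_iff, hij]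
  have h1 : i.castSucc ≠ i.succ := Fin.castSucc_lt_succ.ne
  have h2 : i.castSucc ≠ j.succ := by simp [Fin.ext_iff]; omega
  have h3 : i.succ ≠ j.succ := by simp [Fin.ext_iff]; omega
  apply Equiv.symm_bijective.injective
  ext1 p
  simp only [heckeAct_symm_apply, h0, h1, h2, h3, h1.symm, h2.symm, h3.symm, if_false, if_true]
  split_ifs
  all_goals
    rcases le_total (ω.symm i.castSucc) (ω.symm i.succ) with h | h <;>
    rcases le_total (ω.symm i.castSucc) (ω.symm j.succ) with h' | h' <;>
    rcases le_total (ω.symm i.succ) (ω.symm j.succ) with h'' | h'' <;>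
    grind

/-- The right action of the letter `i`: it interchanges the entries in positions `i` and `i + 1` of
the one-line notation if they are in increasing order. -/
def heckeActRight {n : ℕ} (i : Fin n) (ω : Perm (Fin (n + 1))) : Perm (Fin (n + 1)) :=
  if ω i.castSucc < ω i.succ then ω * adjTransp i else ω

theorem heckeActRight_one {n : ℕ} (i : Fin n) : heckeActRight i 1 = heckeAct i 1 := by
  simp only [heckeActRight, heckeAct, one_mul, mul_one]
  rfl

theorem adjTransp_lt_iff {n : ℕ} (i : Fin n) (a b : Fin (n + 1))
    (h1 : ¬ (a = i.castSucc ∧ b = i.succ)) (h2 : ¬ (a = i.succ ∧ b = i.castSucc)) :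
    adjTransp i a < adjTransp i b ↔ a < b := by
  refine ⟨fun h => ?_, fun h => adjTransp_lt i a b h h1⟩
  rw [← adjTransp_adjTransp i a, ← adjTransp_adjTransp i b]
  refine adjTransp_lt i _ _ h fun ⟨ha, hb⟩ => h2 ⟨?_, ?_⟩
  · rw [← adjTransp_adjTransp i a, ha, adjTransp_castSucc]
  · rw [← adjTransp_adjTransp i b, hb, adjTransp_succ]

/-- The two actions commute. The one case in which `s_i` and `s_j` interfere is
`s_i ω = ω s_j`, where both actions do the same. -/
theorem heckeAct_heckeActRight_comm {n : ℕ} (i j : Fin n) (ω : Perm (Fin (n + 1))) :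
    heckeAct i (heckeActRight j ω) = heckeActRight j (heckeAct i ω) := by
  have hs : ∀ q, (ω * adjTransp j).symm q = adjTransp j (ω.symm q) := fun q => by
    rw [← Perm.inv_def, mul_inv_rev, adjTransp_inv]
    rfl
  have hi : i.castSucc < i.succ := Fin.castSucc_lt_succ
  have hj : j.castSucc < j.succ := Fin.castSucc_lt_succ
  by_cases h1 : ω j.castSucc = i.castSucc ∧ ω j.succ = i.succ
  · obtain ⟨ha, hb⟩ := h1
    have ha' : ω.symm i.castSucc = j.castSucc := by rw [symm_apply_eq, ha]
    have hb' : ω.symm i.succ = j.succ := by rw [symm_apply_eq, hb]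
    have hcomm : adjTransp i * ω = ω * adjTransp j := by
      simp only [adjTransp]
      rw [← ha, ← hb, mul_swap_eq_swap_mul]
    simp only [heckeAct, heckeActRight, ha, hb, ha', hb', hi, hj, if_true, hs, Perm.mul_apply,
      adjTransp_castSucc, adjTransp_succ, hi.not_gt, hj.not_gt, if_false, hcomm]
  by_cases h2 : ω j.castSucc = i.succ ∧ ω j.succ = i.castSucc
  · obtain ⟨ha, hb⟩ := h2
    have ha' : ω.symm i.castSucc = j.succ := by rw [symm_apply_eq, hb]
    have hb' : ω.symm i.succ = j.castSucc := by rw [symm_apply_eq, ha]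
    simp only [heckeAct, heckeActRight, ha, hb, ha', hb', hi.not_gt, hj.not_gt, if_false]
  have e1 : (ω * adjTransp j).symm i.castSucc < (ω * adjTransp j).symm i.succ ↔
      ω.symm i.castSucc < ω.symm i.succ := by
    rw [hs, hs, adjTransp_lt_iff]
    · rintro ⟨ha, hb⟩
      rw [symm_apply_eq] at ha hb
      exact h1 ⟨ha.symm, hb.symm⟩
    · rintro ⟨ha, hb⟩
      rw [symm_apply_eq] at ha hb
      exact h2 ⟨hb.symm, ha.symm⟩
  have e2 : (adjTransp i * ω) j.castSucc < (adjTransp i * ω) j.succ ↔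
      ω j.castSucc < ω j.succ := adjTransp_lt_iff i _ _ h1 h2
  by_cases hl : ω.symm i.castSucc < ω.symm i.succ <;>
    by_cases hr : ω j.castSucc < ω j.succ <;>
    simp only [heckeAct, heckeActRight, hl, hr, e1, e2, if_true, if_false, mul_assoc]

/-! ### The 0-Hecke operators -/

section HeckeOperators

variable (R : Type*) [CommRing R] {n : ℕ}

/-- The linear extension of `heckeAct i` to the free module on the permutations; an element
`∑ v_ω e_ω` of this module is encoded as the function `v`. -/
def heckeOp (i : Fin n) : Module.End R (Perm (Fin (n + 1)) → R) where
  toFun v ω := if ω.symm i.succ < ω.symm i.castSucc then v ω + v (adjTransp i * ω) else 0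
  map_add' v w := by
    ext ω
    simp only [Pi.add_apply]
    split_ifs <;> ring
  map_smul' r v := by
    ext ω
    simp only [Pi.smul_apply, smul_eq_mul, RingHom.id_apply]
    split_ifs <;> ring

/-- The linear extension of `heckeActRight i` to the free module on the permutations. -/
def heckeOpRight (i : Fin n) : Module.End R (Perm (Fin (n + 1)) → R) where
  toFun v ω := if ω i.succ < ω i.castSucc then v ω + v (ω * adjTransp i) else 0
  map_add' v w := by
    ext ω
    simp only [Pi.add_apply]
    split_ifs <;> ring
  map_smul' r v := by
    ext ω
    simp only [Pi.smul_apply, smul_eq_mul, RingHom.id_apply]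
    split_ifs <;> ring

variable {R}

theorem heckeOp_apply (i : Fin n) (v : Perm (Fin (n + 1)) → R) (ω : Perm (Fin (n + 1))) :
    heckeOp R i v ω =
      if ω.symm i.succ < ω.symm i.castSucc then v ω + v (adjTransp i * ω) else 0 := rfl

theorem heckeOpRight_apply (i : Fin n) (v : Perm (Fin (n + 1)) → R) (ω : Perm (Fin (n + 1))) :
    heckeOpRight R i v ω =
      if ω i.succ < ω i.castSucc then v ω + v (ω * adjTransp i) else 0 := rfl

theorem heckeOp_single (i : Fin n) (σ : Perm (Fin (n + 1))) (r : R) :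
    heckeOp R i (Pi.single σ r) = Pi.single (heckeAct i σ) r := by
  have hs : ∀ q, (adjTransp i * σ).symm q = σ.symm (adjTransp i q) := fun q => by
    rw [← Perm.inv_def, mul_inv_rev, adjTransp_inv]
    rfl
  have hne : adjTransp i * σ ≠ σ := fun h => by
    have := mul_eq_right.1 h
    have h1 := adjTransp_castSucc i
    rw [this] at h1
    exact Fin.castSucc_lt_succ.ne h1
  have hne' : σ.symm i.castSucc ≠ σ.symm i.succ :=
    fun h => Fin.castSucc_lt_succ.ne (σ.symm.injective h)
  have hiff : ∀ ω, adjTransp i * ω = σ ↔ ω = adjTransp i * σ := fun ω => by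
    constructor <;> rintro rfl <;> rw [← mul_assoc, adjTransp_mul_self, one_mul]
  ext ω
  rw [heckeOp_apply]
  simp only [Pi.single_apply, hiff]
  unfold heckeAct
  by_cases h1 : ω = σ
  · subst h1
    by_cases h2 : ω.symm i.castSucc < ω.symm i.succ
    · simp [h2, h2.not_gt, hne.symm]
    · simp [h2, lt_of_le_of_ne (not_lt.1 h2) hne'.symm, hne.symm]
  · by_cases h3 : ω = adjTransp i * σ
    · subst h3
      simp only [hs, adjTransp_castSucc, adjTransp_succ, hne, if_false, if_true, zero_add]
      by_cases h2 : σ.symm i.castSucc < σ.symm i.succ <;> simp [h2, hne]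
    · by_cases h2 : σ.symm i.castSucc < σ.symm i.succ <;> simp [h2, h1, h3]

theorem heckeOpRight_single (i : Fin n) (σ : Perm (Fin (n + 1))) (r : R) :
    heckeOpRight R i (Pi.single σ r) = Pi.single (heckeActRight i σ) r := by
  ext ω
  have h := congrFun (heckeOp_single i σ⁻¹ r) ω⁻¹
  have e1 : heckeActRight i σ = (heckeAct i σ⁻¹)⁻¹ := by
    unfold heckeActRight heckeAct
    simp only [← Perm.inv_def, inv_inv]
    split_ifs
    · rw [mul_inv_rev, inv_inv, adjTransp_inv]
    · rw [inv_inv]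
  have e2 : ∀ τ ρ : Perm (Fin (n + 1)), τ⁻¹ = ρ ↔ τ = ρ⁻¹ := fun τ ρ => inv_eq_iff_eq_inv
  have e3 : adjTransp i * ω⁻¹ = (ω * adjTransp i)⁻¹ := by rw [mul_inv_rev, adjTransp_inv]
  rw [heckeOpRight_apply, e1]
  rw [heckeOp_apply] at h
  simp only [Pi.single_apply, ← Perm.inv_def, inv_inv, e3, e2] at h ⊢
  exact h

theorem heckeModule_end_ext {F G : Module.End R (Perm (Fin (n + 1)) → R)}
    (h : ∀ σ, F (Pi.single σ 1) = G (Pi.single σ 1)) : F = G :=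
  LinearMap.pi_ext' fun σ => LinearMap.ext_ring (h σ)

theorem commute_heckeOp_heckeOpRight (i j : Fin n) :
    Commute (heckeOp R i) (heckeOpRight R j) :=
  heckeModule_end_ext fun σ => by
    simp only [Module.End.mul_apply, heckeOp_single, heckeOpRight_single,
      heckeAct_heckeActRight_comm]

variable (R n) in
/-- The operators `heckeOp` indexed by all natural numbers, with value `0` for the indices that
are not letters. These zeros satisfy the relations of a Hecke family as well. -/
def heckeOpNat (i : ℕ) : Module.End R (Perm (Fin (n + 1)) → R) :=
  if h : i < n then heckeOp R ⟨i, h⟩ else 0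

theorem heckeOpNat_val (i : Fin n) : heckeOpNat R n i = heckeOp R i := dif_pos i.2

variable (R n) in
theorem isHeckeFamily_heckeOpNat : IsHeckeFamily (heckeOpNat R n) where
  idem i := by
    unfold heckeOpNat
    split_ifs
    · exact heckeModule_end_ext fun σ => by
        simp only [Module.End.mul_apply, heckeOp_single, heckeAct_heckeAct]
    · simp
  comm i j hij := by
    unfold heckeOpNat
    split_ifs
    · exact heckeModule_end_ext fun σ => by
        simp only [Module.End.mul_apply, heckeOp_single]
        rw [heckeAct_comm hij]
    all_goals simp
  braid i := by
    unfold heckeOpNat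
    split_ifs
    · exact heckeModule_end_ext fun σ => by
        simp only [Module.End.mul_apply, heckeOp_single]
        rw [heckeAct_braid rfl]
    all_goals simp

end HeckeOperators

/-! ### Inversions and reduced words -/

theorem inversionNumber_inv {n : ℕ} (ω : Perm (Fin (n + 1))) :
    inversionNumber ω⁻¹ = inversionNumber ω := by
  unfold inversionNumber
  refine Finset.card_bij' (fun p _ => (ω⁻¹ p.2, ω⁻¹ p.1)) (fun p _ => (ω p.2, ω p.1)) ?_ ?_ ?_ ?_
  all_goals simp +contextual

theorem inversionNumber_one (n : ℕ) : inversionNumber (1 : Perm (Fin (n + 1))) = 0 := by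
  unfold inversionNumber
  rw [Finset.card_eq_zero, Finset.filter_eq_empty_iff]
  rintro ⟨a, b⟩ - ⟨h1, h2⟩
  exact lt_asymm h1 h2

theorem inversionNumber_left_descent {n : ℕ} (ω : Perm (Fin (n + 1))) (i : Fin n)
    (h : ω.symm i.succ < ω.symm i.castSucc) :
    inversionNumber ω = inversionNumber (adjTransp i * ω) + 1 := by
  rw [← inversionNumber_inv ω, inversionNumber_descent ω⁻¹ i h,
    ← inversionNumber_inv (adjTransp i * ω), mul_inv_rev, adjTransp_inv]

theorem inversionNumber_left_ascent {n : ℕ} (ω : Perm (Fin (n + 1))) (i : Fin n)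
    (h : ω.symm i.castSucc < ω.symm i.succ) :
    inversionNumber (adjTransp i * ω) = inversionNumber ω + 1 := by
  have hs : ∀ q, (adjTransp i * ω).symm q = ω.symm (adjTransp i q) := fun q => by
    rw [← Perm.inv_def, mul_inv_rev, adjTransp_inv]
    rfl
  rw [inversionNumber_left_descent (adjTransp i * ω) i, ← mul_assoc, adjTransp_mul_self, one_mul]
  rwa [hs, hs, adjTransp_castSucc, adjTransp_succ]

theorem inversionNumber_left_cases {n : ℕ} (ω : Perm (Fin (n + 1))) (i : Fin n) :
    (ω.symm i.castSucc < ω.symm i.succ ∧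
      inversionNumber (adjTransp i * ω) = inversionNumber ω + 1) ∨
    (ω.symm i.succ < ω.symm i.castSucc ∧
      inversionNumber ω = inversionNumber (adjTransp i * ω) + 1) := by
  rcases lt_trichotomy (ω.symm i.castSucc) (ω.symm i.succ) with h | h | h
  · exact Or.inl ⟨h, inversionNumber_left_ascent ω i h⟩
  · exact absurd (ω.symm.injective h) Fin.castSucc_lt_succ.ne
  · exact Or.inr ⟨h, inversionNumber_left_descent ω i h⟩

/-- The transposition `s_i` for `i < n`, and the identity for all other `i`. -/
def adjTranspNat (n i : ℕ) : Perm (Fin (n + 1)) :=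
  if h : i < n then adjTransp ⟨i, h⟩ else 1

theorem inversionNumber_adjTranspNat_mul_le {n : ℕ} (i : ℕ) (ω : Perm (Fin (n + 1))) :
    inversionNumber (adjTranspNat n i * ω) ≤ inversionNumber ω + 1 := by
  unfold adjTranspNat
  split_ifs with h
  · rcases inversionNumber_left_cases ω ⟨i, h⟩ with h | h <;> omega
  · rw [one_mul]
    omega

theorem inversionNumber_prod_le {n : ℕ} (w : List ℕ) :
    inversionNumber (w.map (adjTranspNat n)).prod ≤ w.length := by
  induction w with
  | nil => simp [inversionNumber_one]
  | cons i w ih =>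
    rw [List.map_cons, List.prod_cons, List.length_cons]
    exact (inversionNumber_adjTranspNat_mul_le i _).trans (by omega)

theorem two_mul_inversionNumber_revPerm (n : ℕ) :
    2 * inversionNumber (Fin.revPerm : Perm (Fin (n + 1))) = n * (n + 1) := by
  have h : inversionNumber (Fin.revPerm : Perm (Fin (n + 1))) =
      ∑ b : Fin (n + 1), b.val := by
    unfold inversionNumber
    simp only [Fin.revPerm_apply, Fin.rev_lt_rev, and_self]
    rw [Finset.card_filter, Fintype.sum_prod_type_right]
    refine Finset.sum_congr rfl fun b _ => ?_
    rw [← Finset.card_filter, Finset.filter_gt_eq_Iio, Fin.card_Iio]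
  rw [h, Fin.sum_univ_eq_sum_range (fun i => i) (n + 1), mul_comm, Finset.sum_range_id_mul_two]
  simp [mul_comm]

section HeckeCoefficients

variable {R : Type*} [CommRing R] {n : ℕ}

theorem heckeFactorProd_cons_apply (p : ℕ × R) (w : List (ℕ × R)) (v ω) :
    heckeFactorProd (heckeOpNat R n) (p :: w) v ω =
      heckeFactorProd (heckeOpNat R n) w v ω +
        p.2 * heckeOpNat R n p.1 (heckeFactorProd (heckeOpNat R n) w v) ω := by
  simp [heckeFactorProd, heckeFactor]

theorem heckeOpNat_apply (i : ℕ) (v : Perm (Fin (n + 1)) → R) (ω) :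
    heckeOpNat R n i v ω =
      if h : i < n then
        if ω.symm (Fin.succ ⟨i, h⟩) < ω.symm (Fin.castSucc ⟨i, h⟩) then
          v ω + v (adjTransp ⟨i, h⟩ * ω) else 0
      else 0 := by
  unfold heckeOpNat
  split_ifs with h1 h2
  · exact (heckeOp_apply _ _ _).trans (if_pos h2)
  · exact (heckeOp_apply _ _ _).trans (if_neg h2)
  · rfl

/-- A product of fewer than `ℓ(ω)` Hecke factors does not involve `ω`. -/
theorem heckeFactorProd_apply_eq_zero (w : List (ℕ × R)) (ω : Perm (Fin (n + 1)))
    (h : w.length < inversionNumber ω) :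
    heckeFactorProd (heckeOpNat R n) w (Pi.single 1 1) ω = 0 := by
  induction w generalizing ω with
  | nil =>
    have : ω ≠ 1 := by
      rintro rfl
      rw [inversionNumber_one] at h
      omega
    simp [heckeFactorProd, this]
  | cons p w ih =>
    rw [List.length_cons] at h
    rw [heckeFactorProd_cons_apply, ih ω (by omega), heckeOpNat_apply]
    split_ifs with h1 h2
    · have := inversionNumber_left_descent ω ⟨p.1, h1⟩ h2
      rw [ih ω (by omega), ih _ (by omega)]
      ring
    all_goals simp

/-- In a product of Hecke factors along a reduced word of `ω`, the coefficient of `ω` is the product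
of all parameters. -/
theorem heckeFactorProd_apply_of_reduced (w : List (ℕ × R)) (ω : Perm (Fin (n + 1)))
    (hprod : (w.map fun p => adjTranspNat n p.1).prod = ω) (h : w.length = inversionNumber ω) :
    heckeFactorProd (heckeOpNat R n) w (Pi.single 1 1) ω = (w.map Prod.snd).prod := by
  induction w generalizing ω with
  | nil =>
    simp only [List.map_nil, List.prod_nil] at hprod
    simp [heckeFactorProd, ← hprod]
  | cons p w ih =>
    rw [List.length_cons] at h
    rw [List.map_cons, List.prod_cons] at hprod
    set τ := (w.map fun p => adjTranspNat n p.1).prod with hτ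
    have hle : inversionNumber τ ≤ w.length := by
      have := inversionNumber_prod_le (n := n) (w.map Prod.fst)
      rwa [List.map_map, List.length_map] at this
    have hi : p.1 < n := by
      by_contra hi
      rw [adjTranspNat, dif_neg hi, one_mul] at hprod
      rw [← hprod] at h
      omega
    have hτω : adjTransp ⟨p.1, hi⟩ * ω = τ := by
      rw [← hprod, adjTranspNat, dif_pos hi, ← mul_assoc, adjTransp_mul_self, one_mul]
    rw [heckeFactorProd_cons_apply, heckeFactorProd_apply_eq_zero w ω (by omega),
      heckeOpNat_apply, dif_pos hi]
    rcases inversionNumber_left_cases ω ⟨p.1, hi⟩ with ⟨-, h2⟩ | ⟨h1, h2⟩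
    · rw [hτω] at h2
      omega
    · rw [hτω] at h2
      rw [if_pos h1, heckeFactorProd_apply_eq_zero w ω (by omega), hτω, ih τ rfl (by omega)]
      simp

/-! ### The staircase word of the longest permutation -/

theorem adjTranspNat_apply_val {i : ℕ} (hi : i < n) (p : Fin (n + 1)) :
    (adjTranspNat n i p).val = if p.val = i then i + 1 else if p.val = i + 1 then i else p.val := by
  rw [adjTranspNat, dif_pos hi, adjTransp, swap_apply_def]
  simp only [Fin.ext_iff, Fin.val_castSucc, Fin.val_succ]
  split_ifs <;> simp

/-- The word `a, a + 1, …, a + l - 1` is a word for a cycle on the points `a, …, a + l`. -/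
theorem diagonalList_perm (a l : ℕ) (hal : a + l ≤ n) (x : ℕ → R) (s : R) (p : Fin (n + 1)) :
    (((diagonalList a l x s).map fun p => adjTranspNat n p.1).prod p).val =
      if p.val = a + l then a else if a ≤ p.val ∧ p.val < a + l then p.val + 1 else p.val := by
  induction l generalizing a x with
  | zero =>
    simp only [diagonalList, List.map_nil, List.prod_nil, Perm.one_apply]
    split_ifs <;> omega
  | succ l ih =>
    rw [diagonalList, List.map_cons, List.prod_cons, Perm.mul_apply,
      adjTranspNat_apply_val (by omega), ih _ (by omega)]
    split_ifs <;> omega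

/-- The letters of `triangleList` form a word for the reversal of the points `a, …, a + l`. -/
theorem triangleList_perm (a l : ℕ) (hal : a + l ≤ n) (x y : ℕ → R) (p : Fin (n + 1)) :
    (((triangleList a l x y).map fun p => adjTranspNat n p.1).prod p).val =
      if a ≤ p.val ∧ p.val ≤ a + l then 2 * a + l - p.val else p.val := by
  induction l generalizing a y p with
  | zero =>
    simp only [triangleList, List.map_nil, List.prod_nil, Perm.one_apply]
    split_ifs <;> omega
  | succ l ih =>
    rw [triangleList, List.map_append, List.prod_append, Perm.mul_apply, ih _ (by omega),
      diagonalList_perm _ _ hal]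
    split_ifs <;> omega

theorem diagonalList_length (a l : ℕ) (x : ℕ → R) (s : R) : (diagonalList a l x s).length = l := by
  induction l generalizing a x with
  | zero => rfl
  | succ l ih => rw [diagonalList, List.length_cons, ih]

theorem two_mul_triangleList_length (a l : ℕ) (x y : ℕ → R) :
    2 * (triangleList a l x y).length = l * (l + 1) := by
  induction l generalizing a y with
  | zero => rfl
  | succ l ih =>
    rw [triangleList, List.length_append, mul_add, ih, diagonalList_length]
    ring

theorem diagonalList_prod (a l : ℕ) (x : ℕ → R) (s : R) :
    ((diagonalList a l x s).map Prod.snd).prod =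
      ∏ i ∈ Finset.range l, (x i + s + x i * s) := by
  induction l generalizing a x with
  | zero => rfl
  | succ l ih =>
    rw [diagonalList, List.map_cons, List.prod_cons, ih, Finset.prod_range_succ', mul_comm]

theorem triangleList_prod (a l : ℕ) (x y : ℕ → R) :
    ((triangleList a l x y).map Prod.snd).prod =
      ∏ j ∈ Finset.range l, ∏ i ∈ Finset.range (l - j), (x i + y j + x i * y j) := by
  induction l generalizing a y with
  | zero => rfl
  | succ l ih =>
    rw [triangleList, List.map_append, List.prod_append, ih, diagonalList_prod,
      Finset.prod_range_succ'
        (fun j => ∏ i ∈ Finset.range (l + 1 - j), (x i + y j + x i * y j))]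
    simp only [Nat.add_sub_add_right, Nat.sub_zero]

end HeckeCoefficients

/-! ### The generating vector of the double Grothendieck polynomials -/

section GrothendieckVector

variable {R : Type*} [CommRing R]

/-- The vector `∑ G_ω(x, y) e_ω` of the double Grothendieck polynomials for `n + 1` points, as the
image of `e_1` under the product `⋯ (h_0(y_0) h_1(y_0) ⋯) (⋯ h_1(x_0) h_0(x_0)) ⋯`. -/
def grothendieckVector (n : ℕ) (x y : ℕ → R) : Perm (Fin (n + 1)) → R :=
  (ascStaircase (heckeOpNat R n) 0 n y * descStaircase (heckeOpNat R n) 0 n x) (Pi.single 1 1)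

theorem grothendieckVector_revPerm (n : ℕ) (x y : ℕ → R) :
    grothendieckVector n x y Fin.revPerm =
      ∏ j ∈ Finset.range n, ∏ i ∈ Finset.range (n - j), (x i + y j + x i * y j) := by
  rw [grothendieckVector, (isHeckeFamily_heckeOpNat R n).ascStaircase_mul_descStaircase,
    heckeFactorProd_apply_of_reduced, triangleList_prod]
  · ext p
    rw [triangleList_perm _ _ (by omega), if_pos (by omega), Fin.revPerm_apply, Fin.val_rev]
    omega
  · have h1 := two_mul_triangleList_length 0 n x y
    have h2 := two_mul_inversionNumber_revPerm n
    omega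

theorem map_heckeFactorProd {S : Type*} [CommRing S] (φ : R →+* S) {n : ℕ} (w : List (ℕ × R))
    (ω : Perm (Fin (n + 1))) :
    φ (heckeFactorProd (heckeOpNat R n) w (Pi.single 1 1) ω) =
      heckeFactorProd (heckeOpNat S n) (w.map (Prod.map id φ)) (Pi.single 1 1) ω := by
  induction w generalizing ω with
  | nil =>
    simp only [heckeFactorProd, List.map_nil, List.prod_nil, Module.End.one_apply, Pi.single_apply]
    split_ifs <;> simp
  | cons p w ih =>
    rw [List.map_cons, heckeFactorProd_cons_apply, heckeFactorProd_cons_apply, map_add, map_mul,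
      ih, heckeOpNat_apply, heckeOpNat_apply]
    simp only [Prod.map_fst, id, Prod.map_snd]
    split_ifs <;> simp [ih]

theorem map_diagonalList {S : Type*} [CommRing S] (φ : R →+* S) (a l : ℕ) (x : ℕ → R) (s : R) :
    (diagonalList a l x s).map (Prod.map id φ) = diagonalList a l (fun i => φ (x i)) (φ s) := by
  induction l generalizing a x with
  | zero => rfl
  | succ l ih => simp [diagonalList, ih]

theorem map_triangleList {S : Type*} [CommRing S] (φ : R →+* S) (a l : ℕ) (x y : ℕ → R) :
    (triangleList a l x y).map (Prod.map id φ) =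
      triangleList a l (fun i => φ (x i)) (fun j => φ (y j)) := by
  induction l generalizing a y with
  | zero => rfl
  | succ l ih => rw [triangleList, List.map_append, ih, map_diagonalList, triangleList]

theorem map_grothendieckVector {S : Type*} [CommRing S] (φ : R →+* S) (n : ℕ) (x y : ℕ → R)
    (ω : Perm (Fin (n + 1))) :
    φ (grothendieckVector n x y ω) =
      grothendieckVector n (fun i => φ (x i)) (fun j => φ (y j)) ω := by
  rw [grothendieckVector, grothendieckVector,
    (isHeckeFamily_heckeOpNat R n).ascStaircase_mul_descStaircase,
    (isHeckeFamily_heckeOpNat S n).ascStaircase_mul_descStaircase, map_heckeFactorProd,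
    map_triangleList]

theorem commute_heckeFactorProd_heckeOpRight {n : ℕ} (w : List (ℕ × R)) (i : Fin n) :
    Commute (heckeFactorProd (heckeOpNat R n) w) (heckeOpRight R i) := by
  refine Commute.list_prod_left _ _ fun F hF => ?_
  obtain ⟨p, -, rfl⟩ := List.mem_map.1 hF
  refine (Commute.one_left _).add_left (Commute.smul_left ?_ _)
  unfold heckeOpNat
  split_ifs
  · exact commute_heckeOp_heckeOpRight _ _
  · exact Commute.zero_left _

/-- Right multiplication of the product of Hecke factors by `h_i(t)`. -/
theorem staircase_mul_heckeFactor_apply {n : ℕ} (x y : ℕ → R) (i : Fin n) (t : R) :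
    (ascStaircase (heckeOpNat R n) 0 n y * (descStaircase (heckeOpNat R n) 0 n x *
        heckeFactor (heckeOpNat R n) i t)) (Pi.single 1 1) =
      grothendieckVector n x y + t • heckeOpRight R i (grothendieckVector n x y) := by
  have hc := (commute_heckeFactorProd_heckeOpRight (triangleList 0 n x y) i).eq
  rw [grothendieckVector, ← mul_assoc,
    (isHeckeFamily_heckeOpNat R n).ascStaircase_mul_descStaircase, ← Module.End.mul_apply, ← hc,
    heckeFactor, heckeOpNat_val]
  simp only [Module.End.mul_apply, LinearMap.add_apply, LinearMap.smul_apply, heckeOp_single,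
    heckeOpRight_single, heckeActRight_one, map_add, map_smul, Module.End.one_apply]

/-- The vector times `h_i(x_{i+1})` is symmetric in `x_i` and `x_{i+1}`. -/
theorem grothendieckVector_swap [IsDomain R] {n : ℕ} (x y : ℕ → R) (i : Fin n)
    (hx : 1 + x i ≠ 0) :
    grothendieckVector n x y + x (i + 1) • heckeOpRight R i (grothendieckVector n x y) =
      grothendieckVector n (fun j => x (swap i.val (i + 1) j)) y +
        x i • heckeOpRight R i (grothendieckVector n (fun j => x (swap i.val (i + 1) j)) y) := by
  have hreg : IsSMulRegular (Module.End R (Perm (Fin (n + 1)) → R)) (1 + x i) :=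
    fun F G h => LinearMap.ext fun v => funext fun ω =>
      mul_left_cancel₀ hx (congrFun (LinearMap.congr_fun h v) ω)
  have h := (isHeckeFamily_heckeOpNat R n).descStaircase_mul_heckeFactor n i i.2 0 x hreg
  rw [zero_add] at h
  rw [← staircase_mul_heckeFactor_apply, ← staircase_mul_heckeFactor_apply, h]

end GrothendieckVector

/-! ### Double Grothendieck polynomials as coefficients -/

/-- The variable `x_{i+1}` for `i < N`, and `0` for all other `i`. -/
noncomputable def xVar (N i : ℕ) : MvPolynomial (XY N) ℤ :=
  if h : i < N then X (Sum.inl ⟨i, h⟩) else 0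

/-- The variable `y_{j+1}` for `j < N`, and `0` for all other `j`. -/
noncomputable def yVar (N j : ℕ) : MvPolynomial (XY N) ℤ :=
  if h : j < N then X (Sum.inr ⟨j, h⟩) else 0

theorem xVar_val {N : ℕ} (i : Fin N) : xVar N i = X (Sum.inl i) := dif_pos i.2

theorem yVar_val {N : ℕ} (j : Fin N) : yVar N j = X (Sum.inr j) := dif_pos j.2

theorem rename_swap_xVar {N : ℕ} (a b : Fin N) (i : ℕ) :
    rename (swap (Sum.inl a) (Sum.inl b)) (xVar N i) = xVar N (swap a.val b.val i) := by
  by_cases h : i < N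
  · have hs : swap (Sum.inl a : XY N) (Sum.inl b) (Sum.inl ⟨i, h⟩) =
        Sum.inl (swap a b ⟨i, h⟩) := by
      simp only [swap_apply_def, Sum.inl.injEq]
      split_ifs <;> rfl
    rw [xVar, dif_pos h, rename_X, hs, ← xVar_val]
    congr 1
    simp only [swap_apply_def, Fin.ext_iff]
    split_ifs <;> rfl
  · rw [xVar, dif_neg h, map_zero, swap_apply_of_ne_of_ne (by omega) (by omega), xVar, dif_neg h]

theorem rename_swap_yVar {N : ℕ} (a b : Fin N) (j : ℕ) :
    rename (swap (Sum.inl a) (Sum.inl b)) (yVar N j) = yVar N j := by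
  unfold yVar
  split_ifs
  · rw [rename_X, swap_apply_of_ne_of_ne (by simp) (by simp)]
  · simp

/-- The recursion `π_i G_ω = G_{ω s_i}` at a descent `i` of `ω`: the symmetry of the vector times
`h_i(x_{i+1})`, read off at `ω s_i`, says that `G_{ω s_i}` is symmetric in `x_i` and `x_{i+1}`, and
read off at `ω`, that it is the divided difference of `(1 + x_{i+1}) G_ω`. -/
theorem isobaric_grothendieckVector {n : ℕ} (i : Fin n) (ω : Perm (Fin (n + 1)))
    (h : ω i.succ < ω i.castSucc) :
    isobaric i (grothendieckVector n (xVar (n + 1)) (yVar (n + 1)) ω) =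
      grothendieckVector n (xVar (n + 1)) (yVar (n + 1)) (ω * adjTransp i) := by
  have hx0 : xVar (n + 1) i = X (Sum.inl i.castSucc) := xVar_val i.castSucc
  have hx1 : xVar (n + 1) (i + 1) = X (Sum.inl i.succ) := xVar_val i.succ
  have hne : (1 + xVar (n + 1) i : MvPolynomial (XY (n + 1)) ℤ) ≠ 0 := fun h0 => by
    have := congrArg constantCoeff h0
    rw [hx0] at this
    simp at this
  have key := grothendieckVector_swap (xVar (n + 1)) (yVar (n + 1)) i hne
  set G := grothendieckVector n (xVar (n + 1)) (yVar (n + 1)) with hG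
  set G' := grothendieckVector n (fun j => xVar (n + 1) (swap i.val (i + 1) j)) (yVar (n + 1))
    with hG'
  have hren : ∀ σ, rename (swap (Sum.inl i.castSucc) (Sum.inl i.succ)) (G σ) = G' σ := fun σ => by
    have := map_grothendieckVector
      (rename (R := ℤ) (swap (Sum.inl i.castSucc : XY (n + 1)) (Sum.inl i.succ))).toRingHom n
      (xVar (n + 1)) (yVar (n + 1)) σ
    simp only [AlgHom.toRingHom_eq_coe, RingHom.coe_coe, rename_swap_xVar, rename_swap_yVar]
      at this
    exact this
  rw [hx0, hx1] at key
  have h1 := congrFun key ω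
  have h2 := congrFun key (ω * adjTransp i)
  have h3 : ¬ (ω * adjTransp i) i.succ < (ω * adjTransp i) i.castSucc := by
    rw [Perm.mul_apply, Perm.mul_apply, adjTransp_castSucc, adjTransp_succ]
    exact h.not_gt
  simp only [Pi.add_apply, Pi.smul_apply, heckeOpRight_apply, h, h3, if_true, if_false,
    smul_eq_mul, mul_zero, add_zero] at h1 h2
  have hab : (Sum.inl i.castSucc : XY (n + 1)) ≠ Sum.inl i.succ := fun e =>
    Fin.castSucc_lt_succ.ne (Sum.inl_injective e)
  have hd1 := (dividedDifference_eq_iff hab (G ω) _).1 rfl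
  have hd2 := (dividedDifference_eq_iff hab (X (Sum.inl i.succ) * G ω) _).1 rfl
  rw [map_mul, rename_X, swap_apply_right, hren] at hd2
  rw [hren] at hd1
  refine mul_left_cancel₀ (sub_ne_zero.2 fun e => hab (X_injective (R := ℤ) e)) ?_
  rw [isobaric, mul_add, ← hd1, ← hd2]
  rw [← h2] at h1
  linear_combination h1

/-- The double Grothendieck polynomials are the coefficients of the generating function of Fomin and
Kirillov. -/
theorem doubleGrothendieck_eq_grothendieckVector {n : ℕ} (ω : Perm (Fin (n + 1))) :
    doubleGrothendieck ω = grothendieckVector n (xVar (n + 1)) (yVar (n + 1)) ω := by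
  -- The suffixes of a reduced word are reduced, and each further letter is a descent of the
  -- permutation reached so far.
  have hword : ∀ (w : List (Fin n)) (τ : Perm (Fin (n + 1))), IsReducedWord w τ →
      isobaricWord w (grothendieckVector n (xVar (n + 1)) (yVar (n + 1)) Fin.revPerm) =
        grothendieckVector n (xVar (n + 1)) (yVar (n + 1)) (Fin.revPerm * τ⁻¹) := by
    intro w
    induction w with
    | nil =>
      rintro τ ⟨rfl, -⟩
      simp [isobaricWord]
    | cons i w ih =>
      rintro τ ⟨hτ, hlen⟩
      rw [List.map_cons, List.prod_cons] at hτ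
      set ρ := (w.map adjTransp).prod with hρ
      have hle : inversionNumber ρ ≤ w.length := by
        have := inversionNumber_prod_le (n := n) (w.map Fin.val)
        rw [List.map_map, List.length_map] at this
        have he : adjTranspNat n ∘ Fin.val = (adjTransp : Fin n → _) :=
          funext fun j => dif_pos j.2
        rwa [he] at this
      rw [List.length_cons, ← hτ] at hlen
      rcases inversionNumber_left_cases ρ i with ⟨h1, h2⟩ | ⟨h1, h2⟩
      · have := ih ρ ⟨rfl, by omega⟩
        rw [isobaricWord] at this ⊢
        rw [List.foldr_cons, this, isobaric_grothendieckVector, ← hτ, mul_inv_rev, adjTransp_inv,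
          mul_assoc]
        simpa [Perm.inv_def] using h1
      · omega
  -- The defining product is the coefficient of the longest permutation.
  have hbase : grothendieckVector n (xVar (n + 1)) (yVar (n + 1)) Fin.revPerm =
      ∏ p : Fin (n + 1) × Fin (n + 1) with (p.1.val + 1) + (p.2.val + 1) ≤ n + 1,
        (X (Sum.inl p.1) + X (Sum.inr p.2) + X (Sum.inl p.1) * X (Sum.inr p.2)) := by
    rw [grothendieckVector_revPerm, Finset.prod_filter, Fintype.prod_prod_type_right]
    simp only [← xVar_val, ← yVar_val]
    rw [Fin.prod_univ_eq_prod_range (fun j => ∏ i : Fin (n + 1), if i.val + 1 + (j + 1) ≤ n + 1 then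
      xVar (n + 1) i + yVar (n + 1) j + xVar (n + 1) i * yVar (n + 1) j else 1) (n + 1)]
    have hinner : ∀ j, (∏ i : Fin (n + 1), if i.val + 1 + (j + 1) ≤ n + 1 then
        xVar (n + 1) i + yVar (n + 1) j + xVar (n + 1) i * yVar (n + 1) j else 1) =
        ∏ i ∈ Finset.range (n - j),
          (xVar (n + 1) i + yVar (n + 1) j + xVar (n + 1) i * yVar (n + 1) j) := fun j => by
      rw [Fin.prod_univ_eq_prod_range (fun i => if i + 1 + (j + 1) ≤ n + 1 then
        xVar (n + 1) i + yVar (n + 1) j + xVar (n + 1) i * yVar (n + 1) j else 1) (n + 1),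
        ← Finset.prod_filter]
      refine Finset.prod_congr ?_ fun _ _ => rfl
      ext i
      simp only [Finset.mem_filter, Finset.mem_range]
      omega
    simp only [hinner]
    rw [Finset.prod_range_succ]
    simp
  rw [doubleGrothendieck, ← hbase, isobaricPerm, reducedWord,
    hword _ _ (exists_isReducedWord (ω⁻¹ * Fin.revPerm)).choose_spec]
  simp

/-! ### Restriction to the permutations that fix the first `m` points -/

theorem shiftPerm_castAdd (m : ℕ) {k : ℕ} (ω : Perm (Fin (k + 1))) (p : Fin m) :
    shiftPerm m ω (Fin.castAdd (k + 1) p : Fin (m + (k + 1))) =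
      (Fin.castAdd (k + 1) p : Fin (m + (k + 1))) := by
  rw [shiftPerm, permCongr_apply, finSumFinEquiv_symm_apply_castAdd]
  rfl

theorem shiftPerm_natAdd (m : ℕ) {k : ℕ} (ω : Perm (Fin (k + 1))) (q : Fin (k + 1)) :
    shiftPerm m ω (Fin.natAdd m q : Fin (m + (k + 1))) =
      (Fin.natAdd m (ω q) : Fin (m + (k + 1))) := by
  rw [shiftPerm, permCongr_apply, finSumFinEquiv_symm_apply_natAdd]
  rfl

theorem shiftPerm_ext {m k : ℕ} {σ τ : Perm (Fin (m + k + 1))}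
    (h1 : ∀ p : Fin m, σ (Fin.castAdd (k + 1) p : Fin (m + (k + 1))) =
      τ (Fin.castAdd (k + 1) p : Fin (m + (k + 1))))
    (h2 : ∀ q : Fin (k + 1), σ (Fin.natAdd m q : Fin (m + (k + 1))) =
      τ (Fin.natAdd m q : Fin (m + (k + 1)))) : σ = τ :=
  Equiv.ext fun p => Fin.addCases (motive := fun p : Fin (m + (k + 1)) => σ p = τ p) h1 h2 p

theorem shiftPerm_one (m k : ℕ) : shiftPerm m (1 : Perm (Fin (k + 1))) = 1 :=
  shiftPerm_ext (shiftPerm_castAdd m 1) (shiftPerm_natAdd m 1)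

theorem shiftPerm_mul (m : ℕ) {k : ℕ} (σ τ : Perm (Fin (k + 1))) :
    shiftPerm m (σ * τ) = shiftPerm m σ * shiftPerm m τ :=
  shiftPerm_ext
    (fun p => by simp only [Perm.mul_apply, shiftPerm_castAdd])
    (fun q => by simp only [Perm.mul_apply, shiftPerm_natAdd])

theorem shiftPerm_symm (m : ℕ) {k : ℕ} (ω : Perm (Fin (k + 1))) :
    (shiftPerm m ω).symm = shiftPerm m ω.symm := by
  rw [← Perm.inv_def, inv_eq_iff_mul_eq_one, ← shiftPerm_mul, ← Perm.inv_def, mul_inv_cancel,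
    shiftPerm_one]

theorem shiftPerm_injective (m k : ℕ) :
    Function.Injective (shiftPerm m : Perm (Fin (k + 1)) → Perm (Fin (m + k + 1))) := by
  intro σ τ h
  ext q
  have := congrArg (fun ρ : Perm (Fin (m + k + 1)) =>
    (ρ (Fin.natAdd m q : Fin (m + (k + 1)))).val) h
  simpa [shiftPerm_natAdd] using this

theorem shiftPerm_adjTransp (m : ℕ) {k : ℕ} (i : Fin k) :
    shiftPerm m (adjTransp i) = adjTransp (Fin.natAdd m i) := by
  refine shiftPerm_ext (fun p => ?_) (fun q => ?_)
  · rw [shiftPerm_castAdd, adjTransp, swap_apply_of_ne_of_ne]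
    all_goals
      intro h
      have h' := congrArg Fin.val h
      have := p.2
      simp at h'
      omega
  · rw [shiftPerm_natAdd]
    apply Fin.ext
    simp only [adjTransp, swap_apply_def, Fin.ext_iff, Fin.val_natAdd, Fin.val_castSucc,
      Fin.val_succ]
    split_ifs <;> simp <;> omega

section Restriction

variable {R : Type*} [CommRing R] {m k : ℕ}

variable (R m k) in
/-- The restriction of a vector to the permutations `ω̂`, as a vector on the permutations `ω`. -/
def shiftRestrict : (Perm (Fin (m + k + 1)) → R) →ₗ[R] (Perm (Fin (k + 1)) → R) :=
  LinearMap.funLeft R R (shiftPerm m)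

theorem shiftRestrict_single_one :
    shiftRestrict R m k (Pi.single 1 1) = Pi.single 1 1 := by
  ext ω
  have h : shiftPerm m ω = 1 ↔ ω = 1 := by
    rw [← shiftPerm_one m k, (shiftPerm_injective m k).eq_iff]
  simp only [shiftRestrict, LinearMap.funLeft_apply, Pi.single_apply, h]

/-- No permutation `ω̂` has a left descent at one of the first `m` letters. -/
theorem shiftRestrict_heckeOpNat_of_lt {j : ℕ} (hj : j < m) (v : Perm (Fin (m + k + 1)) → R) :
    shiftRestrict R m k (heckeOpNat R (m + k) j v) = 0 := by
  ext ω
  have hj' : j < m + k := by omega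
  have h1 : ((shiftPerm m ω).symm (Fin.castSucc ⟨j, hj'⟩)).val = j := by
    rw [shiftPerm_symm]
    exact congrArg Fin.val (shiftPerm_castAdd m ω.symm ⟨j, hj⟩)
  have h2 : j < ((shiftPerm m ω).symm (Fin.succ ⟨j, hj'⟩)).val := by
    rw [shiftPerm_symm]
    by_cases h : j + 1 < m
    · rw [show ((shiftPerm m ω.symm) (Fin.succ ⟨j, hj'⟩)).val = j + 1 from
        congrArg Fin.val (shiftPerm_castAdd m ω.symm ⟨j + 1, h⟩)]
      omega
    · have h3 : (Fin.succ ⟨j, hj'⟩ : Fin (m + k + 1)) =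
          (Fin.natAdd m (0 : Fin (k + 1)) : Fin (m + (k + 1))) :=
        Fin.ext (by simp; omega)
      rw [h3, shiftPerm_natAdd, Fin.val_natAdd]
      omega
  have h4 : ¬ (shiftPerm m ω).symm (Fin.succ ⟨j, hj'⟩) <
      (shiftPerm m ω).symm (Fin.castSucc ⟨j, hj'⟩) := by
    rw [Fin.lt_def]
    omega
  simp only [shiftRestrict, LinearMap.funLeft_apply]
  rw [heckeOpNat_apply, dif_pos hj', if_neg h4]
  rfl

theorem shiftRestrict_heckeOpNat_add (i : ℕ) (v : Perm (Fin (m + k + 1)) → R) :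
    shiftRestrict R m k (heckeOpNat R (m + k) (m + i) v) =
      heckeOpNat R k i (shiftRestrict R m k v) := by
  ext ω
  simp only [shiftRestrict, LinearMap.funLeft_apply]
  rw [heckeOpNat_apply, heckeOpNat_apply]
  by_cases hi : i < k
  · have hi' : m + i < m + k := by omega
    have h1 : (shiftPerm m ω).symm (Fin.succ ⟨m + i, hi'⟩) =
        (Fin.natAdd m (ω.symm (Fin.succ ⟨i, hi⟩)) : Fin (m + (k + 1))) := by
      rw [shiftPerm_symm]
      exact shiftPerm_natAdd m ω.symm (Fin.succ ⟨i, hi⟩)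
    have h2 : (shiftPerm m ω).symm (Fin.castSucc ⟨m + i, hi'⟩) =
        (Fin.natAdd m (ω.symm (Fin.castSucc ⟨i, hi⟩)) : Fin (m + (k + 1))) := by
      rw [shiftPerm_symm]
      exact shiftPerm_natAdd m ω.symm (Fin.castSucc ⟨i, hi⟩)
    have h3 : adjTransp ⟨m + i, hi'⟩ * shiftPerm m ω = shiftPerm m (adjTransp ⟨i, hi⟩ * ω) := by
      rw [shiftPerm_mul, shiftPerm_adjTransp]
      rfl
    have h4 : (shiftPerm m ω).symm (Fin.succ ⟨m + i, hi'⟩) <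
        (shiftPerm m ω).symm (Fin.castSucc ⟨m + i, hi'⟩) ↔
        ω.symm (Fin.succ ⟨i, hi⟩) < ω.symm (Fin.castSucc ⟨i, hi⟩) := by
      rw [h1, h2]
      rw [Fin.lt_def, Fin.lt_def, Fin.val_natAdd, Fin.val_natAdd]
      omega
    simp only [hi, hi', dif_pos, h3, h4, LinearMap.funLeft_apply]
  · rw [dif_neg hi, dif_neg (by omega)]

theorem shiftRestrict_heckeFactor_of_lt {j : ℕ} (hj : j < m) (t : R)
    (v : Perm (Fin (m + k + 1)) → R) :
    shiftRestrict R m k (heckeFactor (heckeOpNat R (m + k)) j t v) = shiftRestrict R m k v := by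
  simp [heckeFactor, shiftRestrict_heckeOpNat_of_lt hj]

theorem shiftRestrict_heckeFactor_add (i : ℕ) (t : R) (v : Perm (Fin (m + k + 1)) → R) :
    shiftRestrict R m k (heckeFactor (heckeOpNat R (m + k)) (m + i) t v) =
      heckeFactor (heckeOpNat R k) i t (shiftRestrict R m k v) := by
  simp [heckeFactor, shiftRestrict_heckeOpNat_add]

theorem shiftRestrict_ascProd_add (i l : ℕ) (t : R) (v : Perm (Fin (m + k + 1)) → R) :
    shiftRestrict R m k (ascProd (heckeOpNat R (m + k)) (m + i) l t v) =
      ascProd (heckeOpNat R k) i l t (shiftRestrict R m k v) := by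
  induction l generalizing i with
  | zero => rfl
  | succ l ih =>
    rw [ascProd, ascProd, Module.End.mul_apply, Module.End.mul_apply,
      shiftRestrict_heckeFactor_add, add_assoc m i 1, ih]

theorem shiftRestrict_descProd_add (i l : ℕ) (t : R) (v : Perm (Fin (m + k + 1)) → R) :
    shiftRestrict R m k (descProd (heckeOpNat R (m + k)) (m + i) l t v) =
      descProd (heckeOpNat R k) i l t (shiftRestrict R m k v) := by
  induction l generalizing i v with
  | zero => rfl
  | succ l ih =>
    rw [descProd, descProd, Module.End.mul_apply, Module.End.mul_apply, add_assoc m i 1, ih,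
      shiftRestrict_heckeFactor_add]

theorem shiftRestrict_ascProd {a d : ℕ} (had : a + d = m) (l : ℕ) (t : R)
    (v : Perm (Fin (m + k + 1)) → R) :
    shiftRestrict R m k (ascProd (heckeOpNat R (m + k)) a (l + d) t v) =
      ascProd (heckeOpNat R k) 0 l t (shiftRestrict R m k v) := by
  induction d generalizing a with
  | zero =>
    obtain rfl : a = m := had
    exact shiftRestrict_ascProd_add 0 l t v
  | succ d ih =>
    rw [← add_assoc, ascProd, Module.End.mul_apply, shiftRestrict_heckeFactor_of_lt (by omega),
      ih (by omega)]

theorem shiftRestrict_descProd {a d : ℕ} (had : a + d = m) (l : ℕ) (t : R)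
    (v : Perm (Fin (m + k + 1)) → R) :
    shiftRestrict R m k (descProd (heckeOpNat R (m + k)) a (l + d) t v) =
      descProd (heckeOpNat R k) 0 l t (shiftRestrict R m k v) := by
  induction d generalizing a v with
  | zero =>
    obtain rfl : a = m := had
    exact shiftRestrict_descProd_add 0 l t v
  | succ d ih =>
    rw [← add_assoc, descProd, Module.End.mul_apply, ih (by omega),
      shiftRestrict_heckeFactor_of_lt (by omega)]

theorem descStaircase_of_eq_zero {A : Type*} [Ring A] [Algebra R A] (u : ℕ → A) (a l : ℕ)
    (x : ℕ → R) (hx : ∀ i, 0 < i → x i = 0) : descStaircase u a l x = descProd u a l (x 0) := by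
  cases l with
  | zero => rfl
  | succ l =>
    rw [descStaircase, show (fun i => x (i + 1)) = fun _ => 0 from funext fun i => hx _ (by omega),
      descStaircase_zero, mul_one]

theorem ascStaircase_of_eq_zero {A : Type*} [Ring A] [Algebra R A] (u : ℕ → A) (a l : ℕ)
    (y : ℕ → R) (hy : ∀ j, 0 < j → y j = 0) : ascStaircase u a l y = ascProd u a l (y 0) := by
  cases l with
  | zero => rfl
  | succ l =>
    rw [ascStaircase, show (fun i => y (i + 1)) = fun _ => 0 from funext fun i => hy _ (by omega),
      ascStaircase_zero, one_mul]

/-- If `x_i = 0` for `i > d`, then under restriction the remaining `d + 1` descending products of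
the staircase all run over the same `k` letters, since the letters below `m` act trivially. -/
theorem shiftRestrict_descStaircase {a d l : ℕ} (had : a + d = m) (hl : l = k + d) (x : ℕ → R)
    (hx : ∀ i, d < i → x i = 0) (v : Perm (Fin (m + k + 1)) → R) :
    shiftRestrict R m k (descStaircase (heckeOpNat R (m + k)) a l x v) =
      (List.ofFn fun i : Fin (d + 1) => descProd (heckeOpNat R k) 0 k (x i)).prod
        (shiftRestrict R m k v) := by
  subst hl
  induction d generalizing a x v with
  | zero =>
    rw [descStaircase_of_eq_zero _ _ _ _ hx, shiftRestrict_descProd had]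
    simp
  | succ d ih =>
    rw [← add_assoc, descStaircase, Module.End.mul_apply, add_assoc k d 1,
      shiftRestrict_descProd had, ih (by omega) _ fun i hi => hx _ (by omega),
      List.ofFn_succ (n := d + 1), List.prod_cons, Module.End.mul_apply]
    rfl

theorem shiftRestrict_ascStaircase {a d l : ℕ} (had : a + d = m) (hl : l = k + d) (y : ℕ → R)
    (hy : ∀ j, d < j → y j = 0) (v : Perm (Fin (m + k + 1)) → R) :
    shiftRestrict R m k (ascStaircase (heckeOpNat R (m + k)) a l y v) =
      (List.ofFn fun j : Fin (d + 1) => ascProd (heckeOpNat R k) 0 k (y j)).reverse.prod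
        (shiftRestrict R m k v) := by
  subst hl
  induction d generalizing a y v with
  | zero =>
    rw [ascStaircase_of_eq_zero _ _ _ _ hy, shiftRestrict_ascProd had]
    simp
  | succ d ih =>
    rw [← add_assoc, ascStaircase, Module.End.mul_apply, add_assoc k d 1,
      ih (by omega) _ fun j hj => hy _ (by omega), shiftRestrict_ascProd had,
      List.ofFn_succ (n := d + 1), List.reverse_cons, List.prod_append, Module.End.mul_apply]
    simp

end Restriction

theorem truncateXY_xVar {M N : ℕ} (h : M ≤ N) (i : ℕ) :
    truncateXY M N (xVar N i) = xVar M i := by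
  unfold xVar
  split_ifs with h1 h2 h2
  · simp [truncateXY, h2]
  · simp [truncateXY, h2]
  · omega
  · simp

theorem truncateXY_yVar {M N : ℕ} (h : M ≤ N) (j : ℕ) :
    truncateXY M N (yVar N j) = yVar M j := by
  unfold yVar
  split_ifs with h1 h2 h2
  · simp [truncateXY, h2]
  · simp [truncateXY, h2]
  · omega
  · simp

/-- The stable polynomial as a coefficient of a product of `2 m + 2` factors over the same `k`
letters. -/
theorem stableDoubleGrothendieck_eq (m : ℕ) {k : ℕ} (ω : Perm (Fin (k + 1))) :
    stableDoubleGrothendieck m ω =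
      ((List.ofFn fun j : Fin (m + 1) => ascProd (heckeOpNat (MvPolynomial (XY (m + 1)) ℤ) k) 0 k
          (X (Sum.inr j) : MvPolynomial (XY (m + 1)) ℤ)).reverse.prod *
        (List.ofFn fun i : Fin (m + 1) => descProd (heckeOpNat (MvPolynomial (XY (m + 1)) ℤ) k) 0 k
          (X (Sum.inl i) : MvPolynomial (XY (m + 1)) ℤ)).prod) (Pi.single 1 1) ω := by
  have h1 := map_grothendieckVector (truncateXY (m + 1) (m + k + 1)).toRingHom (m + k)
    (xVar (m + k + 1)) (yVar (m + k + 1)) (shiftPerm m ω)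
  simp only [AlgHom.toRingHom_eq_coe, RingHom.coe_coe,
    truncateXY_xVar (show m + 1 ≤ m + k + 1 by omega),
    truncateXY_yVar (show m + 1 ≤ m + k + 1 by omega)] at h1
  have hx : ∀ i, m < i → xVar (m + 1) i = 0 := fun i hi => dif_neg (by omega)
  have hy : ∀ i, m < i → yVar (m + 1) i = 0 := fun i hi => dif_neg (by omega)
  have h2 := congrFun (shiftRestrict_ascStaircase (R := MvPolynomial (XY (m + 1)) ℤ) (k := k)
    (zero_add m) (add_comm m k) (yVar (m + 1)) hy
    (descStaircase (heckeOpNat _ (m + k)) 0 (m + k) (xVar (m + 1)) (Pi.single 1 1))) ω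
  rw [shiftRestrict_descStaircase (zero_add m) (add_comm m k) _ hx,
    shiftRestrict_single_one] at h2
  simp only [xVar_val, yVar_val] at h2
  rw [stableDoubleGrothendieck, doubleGrothendieck_eq_grothendieckVector, h1]
  exact h2

/-! ### Expansion into double Hecke factorizations -/

section Expansion

variable {R A : Type*} [CommRing R] [Ring A] [Algebra R A]

theorem ascProd_eq_list_prod (u : ℕ → A) (a l : ℕ) (t : R) :
    ascProd u a l t = ((List.range' a l).map fun i => heckeFactor u i t).prod := by
  induction l generalizing a with
  | zero => rfl
  | succ l ih => rw [ascProd, ih, List.range'_succ, List.map_cons, List.prod_cons]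

theorem descProd_eq_list_prod (u : ℕ → A) (a l : ℕ) (t : R) :
    descProd u a l t = ((List.range' a l).reverse.map fun i => heckeFactor u i t).prod := by
  induction l generalizing a with
  | zero => rfl
  | succ l ih => simp [descProd, ih, List.range'_succ]

theorem list_prod_one_add_smul {ι : Type*} (u : ι → A) (l : List ι) (t : R) :
    (l.map fun i => 1 + t • u i).prod =
      (l.sublists'.map fun w => t ^ w.length • (w.map u).prod).sum := by
  induction l with
  | nil => simp
  | cons i l ih =>
    rw [List.map_cons, List.prod_cons, List.sublists'_cons, List.map_append, List.sum_append,
      add_mul, one_mul, ← ih, add_right_inj, ih, List.map_map, ← List.sum_map_mul_left]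
    congr 1
    refine List.map_congr_left fun w _ => ?_
    simp only [Function.comp_apply, List.map_cons, List.prod_cons, List.length_cons,
      smul_mul_smul_comm, pow_succ']

/-- The expansion of a noncommutative product of sums. -/
theorem ofFn_sum_prod {ι : Type*} {M : ℕ} (S : Finset ι) (c : Fin M → ι → R) (T : ι → A) :
    (List.ofFn fun i => ∑ w ∈ S, c i w • T w).prod =
      ∑ φ ∈ Fintype.piFinset fun _ : Fin M => S,
        (∏ i, c i (φ i)) • (List.ofFn fun i => T (φ i)).prod := by
  have h := (MultilinearMap.mkPiAlgebraFin R M A).map_sum_finset (fun i w => c i w • T w)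
    (fun _ => S)
  simpa only [MultilinearMap.map_smul_univ, MultilinearMap.mkPiAlgebraFin_apply] using h

theorem reverse_ofFn_eq {α : Type*} {M : ℕ} (f : Fin M → α) :
    (List.ofFn f).reverse = List.ofFn fun i => f i.rev := by
  apply List.ext_getElem
  · simp
  · intro i h1 h2
    simp only [List.getElem_reverse, List.getElem_ofFn, List.length_ofFn]
    congr 1
    apply Fin.ext
    simp only [Fin.val_rev]
    omega

theorem reverse_ofFn_sum_prod {ι : Type*} {M : ℕ} (S : Finset ι) (c : Fin M → ι → R)
    (T : ι → A) :
    (List.ofFn fun i => ∑ w ∈ S, c i w • T w).reverse.prod =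
      ∑ φ ∈ Fintype.piFinset fun _ : Fin M => S,
        (∏ i, c i (φ i)) • (List.ofFn fun i => T (φ i)).reverse.prod := by
  have h := ((MultilinearMap.mkPiAlgebraFin R M A).domDomCongr Fin.revPerm).map_sum_finset
    (fun i w => c i w • T w) (fun _ => S)
  simp only [reverse_ofFn_eq]
  simpa only [MultilinearMap.map_smul_univ, MultilinearMap.domDomCongr_apply,
    MultilinearMap.mkPiAlgebraFin_apply, Fin.revPerm_apply] using h

/-- The strictly increasing words in the letters `Fin k`. -/
def increasingWords (k : ℕ) : Finset (List (Fin k)) := (List.finRange k).sublists'.toFinset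

/-- The strictly decreasing words in the letters `Fin k`. -/
def decreasingWords (k : ℕ) : Finset (List (Fin k)) :=
  (List.finRange k).reverse.sublists'.toFinset

theorem mem_increasingWords {k : ℕ} (w : List (Fin k)) :
    w ∈ increasingWords k ↔ w.Pairwise (· < ·) := by
  rw [increasingWords, List.mem_toFinset, List.mem_sublists']
  have hs := List.pairwise_lt_finRange k
  exact ⟨fun h => hs.sublist h, fun h => List.sublist_of_subperm_of_pairwise
    (List.subperm_of_subset (h.imp ne_of_lt) fun i _ => List.mem_finRange i) h hs⟩

theorem mem_decreasingWords {k : ℕ} (w : List (Fin k)) :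
    w ∈ decreasingWords k ↔ w.Pairwise (· > ·) := by
  rw [decreasingWords, List.mem_toFinset, List.mem_sublists', ← List.reverse_sublist,
    List.reverse_reverse, ← List.mem_sublists', ← List.mem_toFinset]
  exact (mem_increasingWords _).trans List.pairwise_reverse

theorem ascProd_eq_sum (k : ℕ) (t : R) :
    ascProd (heckeOpNat R k) 0 k t =
      ∑ w ∈ increasingWords k, t ^ w.length • (w.map (heckeOp R)).prod := by
  rw [increasingWords, List.sum_toFinset _ (List.nodup_sublists'.2 (List.nodup_finRange k)),
    ← list_prod_one_add_smul, ascProd_eq_list_prod, ← List.range_eq_range',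
    ← List.map_coe_finRange_eq_range, List.map_map]
  simp only [Function.comp_def, heckeFactor, heckeOpNat_val]

theorem descProd_eq_sum (k : ℕ) (t : R) :
    descProd (heckeOpNat R k) 0 k t =
      ∑ w ∈ decreasingWords k, t ^ w.length • (w.map (heckeOp R)).prod := by
  rw [decreasingWords, List.sum_toFinset _
    (List.nodup_sublists'.2 (List.nodup_reverse.2 (List.nodup_finRange k))),
    ← list_prod_one_add_smul, descProd_eq_list_prod, ← List.range_eq_range',
    ← List.map_coe_finRange_eq_range, ← List.map_reverse, List.map_map]
  simp only [Function.comp_def, heckeFactor, heckeOpNat_val]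

theorem heckeOp_word_apply {k : ℕ} (w : List (Fin k)) :
    (w.map (heckeOp R)).prod (Pi.single 1 1) = Pi.single (w.foldr heckeAct 1) 1 := by
  induction w with
  | nil => rfl
  | cons i w ih =>
    rw [List.map_cons, List.prod_cons, Module.End.mul_apply, ih, heckeOp_single, List.foldr_cons]

theorem heckeOp_readingWord {m k : ℕ} (l r : Fin (m + 1) → List (Fin k)) :
    (List.ofFn fun i => ((l i).map (heckeOp R)).prod).reverse.prod *
        (List.ofFn fun i => ((r i).map (heckeOp R)).prod).prod =
      ((readingWord l r).map (heckeOp R)).prod := by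
  have h : ∀ L : List (List (Fin k)), (L.map fun w => (w.map (heckeOp R)).prod).prod =
      (L.flatten.map (heckeOp R)).prod := fun L => by
    induction L with
    | nil => rfl
    | cons w L ih => simp [ih]
  rw [readingWord, List.map_append, List.prod_append, ← h, ← h, List.map_reverse, List.map_ofFn,
    List.map_ofFn]
  rfl

end Expansion

theorem mainTheorem2 (m k : ℕ) (ω : Equiv.Perm (Fin (k + 1))) :
    stableDoubleGrothendieck m ω =
      ∑ f : DoubleHeckeFactorization m ω, f.weightMonomial := by
  rw [stableDoubleGrothendieck_eq]
  simp only [ascProd_eq_sum, descProd_eq_sum]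
  rw [reverse_ofFn_sum_prod (increasingWords k)
      (fun j w => (X (Sum.inr j) ^ w.length : MvPolynomial (XY (m + 1)) ℤ))
      (fun w => (w.map (heckeOp (MvPolynomial (XY (m + 1)) ℤ))).prod),
    ofFn_sum_prod (decreasingWords k)
      (fun i w => (X (Sum.inl i) ^ w.length : MvPolynomial (XY (m + 1)) ℤ))
      (fun w => (w.map (heckeOp (MvPolynomial (XY (m + 1)) ℤ))).prod),
    Finset.sum_mul_sum]
  simp only [smul_mul_smul_comm, heckeOp_readingWord, LinearMap.sum_apply, LinearMap.smul_apply,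
    Finset.sum_apply, Pi.smul_apply, heckeOp_word_apply, Pi.single_apply, smul_eq_mul, mul_ite,
    mul_one, mul_zero]
  rw [← Finset.sum_product', ← Finset.sum_filter]
  have hmem : ∀ p ∈ ((Fintype.piFinset fun _ : Fin (m + 1) => increasingWords k) ×ˢ
      Fintype.piFinset fun _ : Fin (m + 1) => decreasingWords k).filter
        (fun p => ω = (readingWord p.1 p.2).foldr heckeAct 1),
      (∀ i, (p.1 i).Pairwise (· < ·)) ∧ (∀ i, (p.2 i).Pairwise (· > ·)) ∧
        IsHeckeWord (readingWord p.1 p.2) ω := fun p hp => by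
    simp only [Finset.mem_filter, Finset.mem_product, Fintype.mem_piFinset, mem_increasingWords,
      mem_decreasingWords] at hp
    exact ⟨hp.1.1, hp.1.2, hp.2.symm⟩
  refine Finset.sum_bij' (fun p hp => ⟨p.1, p.2, (hmem p hp).1, (hmem p hp).2.1, (hmem p hp).2.2⟩)
    (fun f _ => (f.left, f.right)) (fun _ _ => Finset.mem_univ _) (fun f _ => ?_)
    (fun _ _ => rfl) (fun _ _ => rfl) (fun p _ => mul_comm _ _)
  simp only [Finset.mem_filter, Finset.mem_product, Fintype.mem_piFinset, mem_increasingWords,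
    mem_decreasingWords]
  exact ⟨⟨f.left_increasing, f.right_decreasing⟩, f.isHeckeWord.symm⟩
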